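/- Say that a graph $G$ has arboricity $\alpha$ if its edges can be partitioned into at most $\alpha$ forests, and let $\mathrm{match}(G)$ be the maximum size of a matching in $G$. Consider randomized one-pass streaming algorithms with memory consisting of words of $O(\log n)$ bits (so that an edge or a counter fits into $O(1)$ words); such an algorithm knows $n$, $\alpha$ and $\varepsilon$ in advance and reads the edges of a graph $G$ on $n$ vertices, each exactly once, in an arbitrary order. For every constant $c$ there is such an algorithm, using $O(\varepsilon^{-2}\log n)$ words of space, with the following property. For all $n\ge 2$, all $\alpha\ge 0$, all $0<\varepsilon\le 1$, every simple graph $G$ on $n$ vertices of arboricity $\alpha$ and every ordering of its edges as a stream, the output $X$ of the algorithm satisfies $$\mathrm{match}(G)\;\le\; X\;\le\;(\alpha+2)(1+\varepsilon)\,\mathrm{match}(G)$$ with probability at least $1-n^{-c}$. The constants in the $O(\cdot)$ bounds depend only on $c$. -/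

import Mathlib

/-! ### Graph notions -/

/-- `G` has arboricity (at most) `α`: the edges of `G` can be partitioned into at most `α` forests
(some of the `α` parts may be empty). -/
def SimpleGraph.HasArboricity {V : Type*} (G : SimpleGraph V) (α : ℕ) : Prop :=
  ∃ F : Fin α → SimpleGraph V,
    (∀ i, (F i).IsAcyclic) ∧
    (∀ i j, i ≠ j → Disjoint (F i).edgeSet (F j).edgeSet) ∧
    G.edgeSet = ⋃ i, (F i).edgeSet

/-- The maximum number of edges of a matching of the finite graph `G`. -/
noncomputable def SimpleGraph.maxMatchingSize {V : Type*} [Fintype V] (G : SimpleGraph V) : ℕ :=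
  sSup {k : ℕ | ∃ M : G.Subgraph, M.IsMatching ∧ M.edgeSet.ncard = k}

/-- `σ` is an insert-only edge stream of `G`: every edge of `G` occurs exactly once, in an
arbitrary order, written with its endpoints in either order; nothing else occurs. -/
def SimpleGraph.IsEdgeStream {V : Type*} (G : SimpleGraph V) (σ : List (V × V)) : Prop :=
  (σ.map fun e => s(e.1, e.2)).Nodup ∧ ∀ e : Sym2 V, e ∈ σ.map (fun e => s(e.1, e.2)) ↔ e ∈ G.edgeSet

/-! ### Randomized one-pass streaming programs on a word machine

The machine has a working memory of `w` cells, each holding one word of `b` bits. It has read-only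
access to a list of parameters that are known before the stream starts and to the current stream
item. Earlier items are accessible only through what has been kept in the working memory. -/

namespace Streaming

/-- A working memory of `w` words of `b` bits each. -/
abbrev Memory (w b : ℕ) : Type := Fin w → Fin (2 ^ b)

/-- The content of cell `a` (`0` if there is no such cell). -/
def Memory.read {w b : ℕ} (m : Memory w b) (a : ℕ) : ℕ :=
  if h : a < w then (m ⟨a, h⟩ : ℕ) else 0

/-- Store `v`, truncated to `b` bits, in cell `a` (no effect if there is no such cell). -/
def Memory.write {w b : ℕ} (m : Memory w b) (a v : ℕ) : Memory w b :=
  if h : a < w then Function.update m ⟨a, h⟩ ⟨v % 2 ^ b, Nat.mod_lt _ (Nat.two_pow_pos b)⟩ else m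

/-- Arithmetic expressions; `cell a` is the content of the memory cell whose address is the value
of `a`. -/
inductive Expr : Type where
  | lit (c : ℕ)
  | param (i : ℕ)
  | item (i : ℕ)
  | cell (a : Expr)
  | add (x y : Expr)
  | sub (x y : Expr)
  | mul (x y : Expr)
  | div (x y : Expr)
  | mod (x y : Expr)
  | lt (x y : Expr)
  | eq (x y : Expr)

/-- Value of an expression, given the parameters, the current stream item and the memory;
comparisons have value `1` or `0`. -/
def Expr.eval {w b : ℕ} (params item : List ℕ) (m : Memory w b) : Expr → ℕ
  | .lit c => c
  | .param i => params.getD i 0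
  | .item i => item.getD i 0
  | .cell a => Memory.read m (a.eval params item m)
  | .add x y => x.eval params item m + y.eval params item m
  | .sub x y => x.eval params item m - y.eval params item m
  | .mul x y => x.eval params item m * y.eval params item m
  | .div x y => x.eval params item m / y.eval params item m
  | .mod x y => x.eval params item m % y.eval params item m
  | .lt x y => if x.eval params item m < y.eval params item m then 1 else 0
  | .eq x y => if x.eval params item m = y.eval params item m then 1 else 0

/-- Commands: `store a e` stores the value of `e` in the cell with address `a`, `flip a` stores
there a fresh fair coin toss, and `loop e s` evaluates `e` once, as a word, and then executes `s`
that many times. The control information of a fixed command consists of its position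
and of one loop counter of one word for each enclosing loop, hence of `O(1)` words. -/
inductive Cmd : Type where
  | skip
  | store (a e : Expr)
  | flip (a : Expr)
  | seq (s t : Cmd)
  | ite (e : Expr) (s t : Cmd)
  | loop (e : Expr) (s : Cmd)

/-- The distribution of the memory after executing a command. -/
noncomputable def Cmd.exec {w b : ℕ} (params item : List ℕ) :
    Cmd → Memory w b → PMF (Memory w b)
  | .skip, m => PMF.pure m
  | .store a e, m =>
      PMF.pure (Memory.write m (a.eval params item m) (e.eval params item m))
  | .flip a, m =>
      (PMF.uniformOfFintype Bool).map fun c => Memory.write m (a.eval params item m) c.toNat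
  | .seq s t, m => (s.exec params item m).bind fun m' => t.exec params item m'
  | .ite e s t, m =>
      if e.eval params item m ≠ 0 then s.exec params item m else t.exec params item m
  | .loop e s, m =>
      (fun μ : PMF (Memory w b) => μ.bind fun m' => s.exec params item m')^[
        e.eval params item m % 2 ^ b] (PMF.pure m)

/-- A one-pass streaming program: `setup` is executed once before the stream, `update` once for
each stream item, and the value of `output` is returned after the stream. -/
structure Program : Type where
  setup : Cmd
  update : Cmd
  output : Expr

/-- The distribution of the output of `A` on a stream, on a machine with `w` words of `b` bits,
all zero at the start. -/
noncomputable def Program.run (A : Program) (w b : ℕ) (params : List ℕ)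
    (stream : List (List ℕ)) : PMF ℕ :=
  (stream.foldl
      (fun (μ : PMF (Memory w b)) item => μ.bind fun m => A.update.exec params item m)
      (A.setup.exec params [] (fun _ => ⟨0, Nat.two_pow_pos b⟩))).map
    fun m => A.output.eval params [] m

/-- The probability of an event under a discrete distribution. -/
noncomputable def prob {X : Type*} (μ : PMF X) (s : Set X) : ℝ := (μ.toOuterMeasure s).toReal

end Streaming

/-! Call an edge of a stream prefix good if at each of its endpoints at most `α` edges of the prefix
arrive after it. The algorithm estimates `peak`, the maximum over all nonempty prefixes of the
number of good edges, and two combinatorial facts place this number between `match(G)` and `(α + 2)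
match(G)`.

Upper bound (`EdgeList.card_good_le`): at each vertex the oldest good edge is followed by at most
`α` others, so the good edges form a graph of maximum degree at most `α + 1`. A graph of maximum
degree `Δ` has at most `(Δ + 1) ν` edges (`Pairing.two_mul_card_edges_le`, from Gallai's lemma).
This applies to every prefix, since a matching of a prefix is a matching of `G`, and needs no
arboricity.

Lower bound (`EdgeList.maxMatchingSize_le_card_good`): at the end of the stream, let `S` be the set
of vertices of degree at least `α + 1`. Their last `α + 1` edges give `(α + 1) #S` incidences, while
arboricity allows at most `α #S` edges inside `S`; the surplus produces at least `#S` good edges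
meeting `S`. Edges avoiding `S` are all good. A matching has at most `#S` edges meeting `S`, so it
is no larger than the set of good edges.

The number of good edges can fall as well as rise, and a sampling rate that was lowered is never
raised again. This is why the maximum over time is estimated: an additive error proportional to
`peak` is then acceptable at every time. Each edge gets a uniform random number below `2 ^ M` and is
kept while it is good and its number is below a threshold, which is halved on overflow. Counters
only grow and thresholds only fall, so what is stored depends only on the history and the current
threshold (`Sketch.live`). A Chernoff and union bound over prefixes and levels (`Sketch.exists_bad`)
shows that, outside a small bad set, all relevant samples are accurate; on that event the threshold
never falls below them (`Sketch.finalBest_accurate`). The remaining lemmas show that the machine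
program realises this process, with independent uniform random numbers (`Sketch.run_program`). -/

open Finset

/-! ### Matchings as involutions, and Gallai's lemma -/

namespace Pairing

variable {V : Type*}

/-- An involution that moves every vertex to itself or along an edge of `G`. -/
def IsPairing (G : SimpleGraph V) (f : V → V) : Prop :=
  (∀ x, f (f x) = x) ∧ ∀ x, f x ≠ x → G.Adj x (f x)

theorem isPairing_id (G : SimpleGraph V) : IsPairing G id := ⟨fun _ => rfl, fun _ h => (h rfl).elim⟩

theorem IsPairing.glue {G : SimpleGraph V} {f g : V → V} (hf : IsPairing G f) (hg : IsPairing G g)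
    (C : Set V) [DecidablePred (· ∈ C)] (hfC : ∀ x ∈ C, f x ∈ C) (hgC : ∀ x ∈ C, g x ∈ C) :
    IsPairing G fun x => if x ∈ C then g x else f x := by
  constructor
  · intro x
    by_cases hx : x ∈ C
    · simp [hx, hgC x hx, hg.1 x]
    · have : f x ∉ C := fun h => hx (by simpa [hf.1 x] using hfC _ h)
      simp [hx, this, hf.1 x]
  · intro x
    by_cases hx : x ∈ C
    · simpa [hx] using hg.2 x
    · simpa [hx] using hf.2 x

/-- The matching given by an involution. -/
def IsPairing.toSubgraph {G : SimpleGraph V} {f : V → V} (hf : IsPairing G f) : G.Subgraph where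
  verts := {x | f x ≠ x}
  Adj x y := f x = y ∧ x ≠ y
  adj_sub := by
    rintro x y ⟨rfl, h⟩
    exact hf.2 x h.symm
  edge_vert := by
    rintro x y ⟨rfl, h⟩
    exact h.symm
  symm := ⟨by
    rintro x y ⟨rfl, h⟩
    exact ⟨hf.1 x, h.symm⟩⟩

theorem IsPairing.isMatching {G : SimpleGraph V} {f : V → V} (hf : IsPairing G f) :
    hf.toSubgraph.IsMatching := fun x hx => ⟨f x, ⟨rfl, Ne.symm hx⟩, fun _ hy => hy.1.symm⟩

variable [Fintype V] [DecidableEq V]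

/-- The vertices covered by the matching `f`. -/
def moved (f : V → V) : Finset V := univ.filter fun x => f x ≠ x

def IsMaxPairing (G : SimpleGraph V) (f : V → V) : Prop :=
  IsPairing G f ∧ ∀ g, IsPairing G g → #(moved g) ≤ #(moved f)

theorem exists_isMaxPairing (G : SimpleGraph V) : ∃ f, IsMaxPairing G f := by
  classical
  obtain ⟨f, hf, hmax⟩ := (univ.filter fun f : V → V => IsPairing G f).exists_max_image
    (fun f => #(moved f)) ⟨id, by simp [isPairing_id]⟩
  exact ⟨f, by simpa using hf, fun g hg => hmax g (by simpa using hg)⟩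

theorem card_moved_glue (f g : V → V) (C : Set V) [DecidablePred (· ∈ C)] :
    #(moved fun x => if x ∈ C then g x else f x) + #(moved fun x => if x ∈ C then f x else g x) =
      #(moved f) + #(moved g) := by
  simp only [moved, card_filter, ← sum_add_distrib]
  refine sum_congr rfl fun x _ => ?_
  by_cases hx : x ∈ C <;> simp [hx, add_comm]

/-- Exchanging two pairings on a common invariant set preserves their total size, so if both were
maximum, neither result can fall short. -/
theorem IsMaxPairing.glue {G : SimpleGraph V} {f g : V → V} (hf : IsMaxPairing G f)
    (hg : IsMaxPairing G g) (C : Set V) [DecidablePred (· ∈ C)] (hfC : ∀ x ∈ C, f x ∈ C)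
    (hgC : ∀ x ∈ C, g x ∈ C) : IsMaxPairing G fun x => if x ∈ C then g x else f x := by
  have h₁ := hf.1.glue hg.1 C hfC hgC
  have h₂ := hg.1.glue hf.1 C hgC hfC
  refine ⟨h₁, fun k hk => ?_⟩
  have := card_moved_glue f g C
  have := hf.2 k hk
  have := hg.2 _ h₂
  have := hg.2 _ hf.1
  omega

/-- In a connected graph of maximum degree at most two at most two vertices have degree at most
one. -/
theorem false_of_three_low_degrees {W : Type*} [Fintype W] [DecidableEq W] (K : SimpleGraph W)
    [DecidableRel K.Adj] (hK : K.Connected) (h2 : ∀ x, K.degree x ≤ 2) {u v w : W} (huv : u ≠ v)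
    (huw : u ≠ w) (hvw : v ≠ w) (hu : K.degree u ≤ 1) (hv : K.degree v ≤ 1)
    (hw : K.degree w ≤ 1) : False := by
  -- Connectedness forces degree sum at least `2 |W| - 2`, whereas three vertices of degree at most
  -- one leave at most `2 |W| - 3`.
  have h1 := hK.card_vert_le_card_edgeSet_add_one
  rw [Nat.card_eq_fintype_card, Nat.card_eq_fintype_card, ← SimpleGraph.edgeFinset_card] at h1
  have h3 := K.sum_degrees_eq_twice_card_edges
  have h4 : ∑ x, K.degree x + ∑ x, (if x ∈ ({u, v, w} : Finset W) then 1 else 0) ≤ ∑ _x : W, 2 := by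
    rw [← sum_add_distrib]
    refine sum_le_sum fun x _ => ?_
    split_ifs with hx
    · simp only [mem_insert, mem_singleton] at hx
      rcases hx with rfl | rfl | rfl <;> omega
    · exact h2 x
  have h5 : #({u, v, w} : Finset W) = 3 := card_eq_three.2 ⟨u, v, w, huv, huw, hvw, rfl⟩
  simp only [sum_ite_mem, univ_inter, sum_const, smul_eq_mul, mul_one, h5, card_univ] at h4
  omega

/-- The union of the two matchings has maximum degree two, and `u`, `v`, `w` have degree at most one
in it. Hence the component of `w` is missing `u` or `v`; replacing `f` by `g` on that component
frees `w` and leaves that vertex free. -/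
theorem exists_isMaxPairing_of_fixed {G : SimpleGraph V} {f g : V → V} (hf : IsMaxPairing G f)
    (hg : IsMaxPairing G g) {u v w : V} (huv : u ≠ v) (huw : u ≠ w) (hvw : v ≠ w)
    (hu : f u = u) (hv : f v = v) (hw : g w = w) :
    ∃ k, IsMaxPairing G k ∧ k w = w ∧ (k u = u ∨ k v = v) := by
  classical
  let K : SimpleGraph V :=
    { Adj := fun x y => x ≠ y ∧ (f x = y ∨ g x = y)
      symm := ⟨by
        rintro x y ⟨h, h' | h'⟩
        · exact ⟨h.symm, Or.inl (by rw [← h', hf.1.1])⟩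
        · exact ⟨h.symm, Or.inr (by rw [← h', hg.1.1])⟩⟩
      loopless := ⟨fun x h => h.1 rfl⟩ }
  let C := K.connectedComponentMk w
  have hclosed : ∀ x y, x ∈ C.supp → K.Adj x y → y ∈ C.supp := fun x y hx hxy =>
    (C.mem_supp_congr_adj hxy).1 hx
  have hfC : ∀ x ∈ C.supp, f x ∈ C.supp := fun x hx => by
    by_cases h : x = f x
    · rwa [← h]
    · exact hclosed x _ hx ⟨h, Or.inl rfl⟩
  have hgC : ∀ x ∈ C.supp, g x ∈ C.supp := fun x hx => by
    by_cases h : x = g x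
    · rwa [← h]
    · exact hclosed x _ hx ⟨h, Or.inr rfl⟩
  have hwC : w ∈ C.supp := SimpleGraph.ConnectedComponent.connectedComponentMk_mem
  refine ⟨_, hf.glue hg C.supp hfC hgC, by simp [hwC, hw], ?_⟩
  by_cases hUC : u ∈ C.supp
  swap
  · exact Or.inl (by simp [hUC, hu])
  by_cases hVC : v ∈ C.supp
  swap
  · exact Or.inr (by simp [hVC, hv])
  exfalso
  have hnb : ∀ (x : C.supp) (s : Finset V), (∀ y, K.Adj x y → y ∈ s) →
      C.toSimpleGraph.degree x ≤ #s := by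
    intro x s hs
    rw [← SimpleGraph.card_neighborFinset_eq_degree]
    refine card_le_card_of_injOn (fun y => (y : V)) (fun y hy => ?_) Subtype.val_injective.injOn
    simp only [SimpleGraph.coe_neighborFinset, SimpleGraph.mem_neighborSet] at hy
    exact hs _ hy
  refine false_of_three_low_degrees C.toSimpleGraph C.connected_toSimpleGraph
    (fun x => (hnb x {f x, g x} ?_).trans card_le_two) (u := ⟨u, hUC⟩) (v := ⟨v, hVC⟩)
    (w := ⟨w, hwC⟩) (by simpa using huv) (by simpa using huw) (by simpa using hvw)
    ((hnb _ {g u} ?_).trans (by simp)) ((hnb _ {g v} ?_).trans (by simp))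
    ((hnb _ {f w} ?_).trans (by simp))
  · rintro y ⟨_, h | h⟩ <;> simp [h]
  · rintro y ⟨h, h' | h'⟩
    · exact (h (hu.symm.trans h')).elim
    · simp [← h']
  · rintro y ⟨h, h' | h'⟩
    · exact (h (hv.symm.trans h')).elim
    · simp [← h']
  · rintro y ⟨h, h' | h'⟩
    · simp [← h']
    · exact (h (hw.symm.trans h')).elim

theorem IsMaxPairing.not_adj_of_fixed {G : SimpleGraph V} {f : V → V} (hf : IsMaxPairing G f)
    {u v : V} (hu : f u = u) (hv : f v = v) : ¬ G.Adj u v := by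
  intro h
  have huv := h.ne
  have hp : IsPairing G (fun x => if x ∈ ({u, v} : Set V) then Equiv.swap u v x else f x) := by
    classical
    refine hf.1.glue ⟨fun x => by simp, fun x hx => ?_⟩ {u, v} ?_ ?_
    · rcases eq_or_ne x u with rfl | hxu
      · simpa using h
      rcases eq_or_ne x v with rfl | hxv
      · simpa using h.symm
      exact (hx (Equiv.swap_apply_of_ne_of_ne hxu hxv)).elim
    · rintro x (rfl | rfl) <;> simp [hu, hv]
    · rintro x (rfl | rfl) <;> simp
  refine (hf.2 _ hp).not_gt (card_lt_card ⟨fun x hx => ?_, fun hs => ?_⟩)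
  · simp only [moved, mem_filter, mem_univ, true_and] at hx ⊢
    have h1 : x ≠ u := fun e => hx (e ▸ hu)
    have h2 : x ≠ v := fun e => hx (e ▸ hv)
    simpa [h1, h2] using hx
  · have := @hs u (by simp [moved, huv.symm])
    simp [moved, hu] at this

/-- If no vertex is covered by all maximum matchings, then a maximum matching misses at most one
vertex of each connected component (Gallai's lemma). -/
theorem fixed_eq_of_reachable {G : SimpleGraph V}
    (hG : ∀ w, ∃ g, IsMaxPairing G g ∧ g w = w) {u v : V} (h : G.Reachable u v) :
    ∀ f, IsMaxPairing G f → f u = u → f v = v → u = v := by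
  rw [SimpleGraph.reachable_iff_reflTransGen] at h
  induction h with
  | refl => exact fun _ _ _ _ => rfl
  | @tail w v h hwv ih =>
    intro f hf hu hv
    by_contra huv
    obtain ⟨g, hg, hw⟩ := hG w
    rcases eq_or_ne u w with rfl | huw
    · exact hf.not_adj_of_fixed hu hv hwv
    obtain ⟨k, hk, hkw, hku | hkv⟩ :=
      exists_isMaxPairing_of_fixed hf hg huv huw hwv.ne' hu hv hw
    · exact huw (ih k hk hku hkw)
    · exact hk.not_adj_of_fixed hkw hkv hwv

/-- With `a` covered vertices and at most one uncovered, the degree sum is at most `#S * min Δ (#S -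
1)`. If `#S = a + 1`, the bound `Δ` on degrees settles `Δ ≤ a` and the bound `#S - 1` settles `a ≤
Δ`. -/
theorem sum_degree_component_le {G : SimpleGraph V} [DecidableRel G.Adj] {Δ : ℕ}
    (hΔ : ∀ x, G.degree x ≤ Δ) {f : V → V} (S : Finset V) (hS : ∀ x ∈ S, ∀ y, G.Adj x y → y ∈ S)
    (hfix : ∀ x ∈ S, ∀ y ∈ S, f x = x → f y = y → x = y) :
    ∑ x ∈ S, G.degree x ≤ (Δ + 1) * #(S.filter fun x => f x ≠ x) := by
  have hsplit := card_filter_add_card_filter_not (s := S) (fun x => f x ≠ x)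
  have h1 : #(S.filter fun x => ¬ f x ≠ x) ≤ 1 := card_le_one.2 fun x hx y hy => by
    simp only [ne_eq, not_not, mem_filter] at hx hy
    exact hfix x hx.1 y hy.1 hx.2 hy.2
  have hd : ∀ x ∈ S, G.degree x ≤ #S - 1 := fun x hx => by
    rw [← SimpleGraph.card_neighborFinset_eq_degree, ← card_erase_of_mem hx]
    refine card_le_card fun y hy => ?_
    rw [SimpleGraph.mem_neighborFinset] at hy
    exact mem_erase.2 ⟨hy.ne', hS x hx y hy⟩
  have h2 : ∑ x ∈ S, G.degree x ≤ #S * Δ := sum_le_card_nsmul _ _ _ fun x _ => hΔ x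
  have h3 : ∑ x ∈ S, G.degree x ≤ #S * (#S - 1) := sum_le_card_nsmul _ _ _ hd
  generalize #(S.filter fun x => f x ≠ x) = a at *
  generalize #(S.filter fun x => ¬ f x ≠ x) = b at *
  generalize ∑ x ∈ S, G.degree x = s at *
  interval_cases b
  · rw [← hsplit] at h2; nlinarith
  · rw [← hsplit] at h2 h3
    simp only [Nat.add_sub_cancel] at h3
    rcases le_total Δ a with h | h <;> nlinarith

theorem IsPairing.two_mul_card_edgeSet {G : SimpleGraph V} {f : V → V} (hf : IsPairing G f) :
    2 * hf.toSubgraph.edgeSet.ncard = #(moved f) := by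
  classical
  have h := hf.toSubgraph.spanningCoe.sum_degrees_eq_twice_card_edges
  have h1 : #hf.toSubgraph.spanningCoe.edgeFinset = hf.toSubgraph.edgeSet.ncard := by
    rw [← Set.ncard_coe_finset, SimpleGraph.coe_edgeFinset]
    rfl
  rw [← h1, ← h, moved, card_filter]
  refine sum_congr rfl fun x _ => ?_
  rw [← SimpleGraph.card_neighborFinset_eq_degree]
  split_ifs with hx
  · refine card_eq_one.2 ⟨f x, ?_⟩
    ext y
    rw [SimpleGraph.mem_neighborFinset, mem_singleton]
    exact ⟨fun h => h.1.symm, fun h => ⟨h.symm, fun e => hx (h.symm.trans e.symm)⟩⟩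
  · refine card_eq_zero.2 (eq_empty_of_forall_notMem fun y hy => hx fun e => ?_)
    rw [SimpleGraph.mem_neighborFinset] at hy
    exact hy.2 (e.symm.trans hy.1)

/-- A graph of maximum degree `Δ` with a maximum matching of size `ν` has at most `(Δ + 1) ν`
edges. -/
theorem two_mul_card_edges_le (G : SimpleGraph V) [DecidableRel G.Adj] {Δ : ℕ}
    (hΔ : ∀ x, G.degree x ≤ Δ) {f : V → V} (hf : IsMaxPairing G f) :
    2 * #G.edgeFinset ≤ (Δ + 1) * #(moved f) := by
  classical
  induction hm : #G.edgeFinset using Nat.strong_induction_on generalizing G f with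
  | _ m ih =>
  subst hm
  -- Either Gallai's lemma applies in every component, or some `w` is covered by all maximum
  -- matchings; removing its edges then costs at most `Δ` edges and lowers the matching number.
  by_cases hG : ∀ w, ∃ g, IsMaxPairing G g ∧ g w = w
  · rw [← G.sum_degrees_eq_twice_card_edges, ← sum_fiberwise (s := univ) (g := G.connectedComponentMk),
      moved, card_eq_sum_card_fiberwise (f := G.connectedComponentMk) (t := univ) (by simp), mul_sum]
    refine sum_le_sum fun C _ => ?_
    rw [filter_filter]
    simp_rw [and_comm (a := f _ ≠ _)]
    rw [← filter_filter]
    refine sum_degree_component_le hΔ _ (fun x hx y hxy => ?_) fun x hx y hy hfx hfy => ?_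
    · simp only [mem_filter, mem_univ, true_and] at hx ⊢
      rw [← hx]
      exact SimpleGraph.ConnectedComponent.sound hxy.symm.reachable
    · simp only [mem_filter, mem_univ, true_and] at hx hy
      exact fixed_eq_of_reachable hG (SimpleGraph.ConnectedComponent.exact (hx.trans hy.symm)) f hf
        hfx hfy
  · push Not at hG
    obtain ⟨w, hw⟩ := hG
    obtain ⟨g, hg⟩ := exists_isMaxPairing (G.deleteIncidenceSet w)
    have hle : G.deleteIncidenceSet w ≤ G := G.deleteIncidenceSet_le w
    have hgG : IsPairing G g := ⟨hg.1.1, fun x hx => hle (hg.1.2 x hx)⟩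
    have hgw : g w = w := by
      by_contra h
      have := hg.1.2 w h
      rw [SimpleGraph.deleteIncidenceSet_adj] at this
      exact this.2.1 rfl
    have hlt : #(moved g) < #(moved f) := by
      refine lt_of_le_of_ne (hf.2 g hgG) fun h => hw g ⟨hgG, fun k hk => ?_⟩ hgw
      rw [h]
      exact hf.2 k hk
    have hcard := G.card_edgeFinset_deleteIncidenceSet w
    have hdw : 0 < G.degree w := by
      have hfw : f w ≠ w := hw f hf
      exact G.degree_pos_iff_exists_adj w |>.2 ⟨_, hf.1.2 w hfw⟩
    have hdle := G.degree_le_card_edgeFinset w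
    have := ih _ (by omega) (G.deleteIncidenceSet w)
      (fun x => (SimpleGraph.degree_le_of_le hle).trans (hΔ x)) hg rfl
    -- Both numbers of covered vertices are even, so the strict inequality `hlt` is a gap of a whole
    -- matching edge.
    have ha := hgG.two_mul_card_edgeSet
    have hb := hf.1.two_mul_card_edgeSet
    generalize (hgG.toSubgraph).edgeSet.ncard = a at ha
    generalize (hf.1.toSubgraph).edgeSet.ncard = b at hb
    rw [← ha] at this hlt
    rw [← hb] at hlt ⊢
    have := hΔ w
    have : a + 1 ≤ b := by omega
    have : 2 * #G.edgeFinset ≤ (Δ + 1) * (2 * a) + 2 * Δ := by omega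
    nlinarith

end Pairing

/-! ### Transfer to matchings as subgraphs; edge count of forests -/

namespace SimpleGraph

variable {V : Type*} [Fintype V]

theorem bddAbove_matchingSize (G : SimpleGraph V) :
    BddAbove {k : ℕ | ∃ M : G.Subgraph, M.IsMatching ∧ M.edgeSet.ncard = k} := by
  classical
  refine ⟨Fintype.card (Sym2 V), ?_⟩
  rintro _ ⟨M, -, rfl⟩
  rw [← Nat.card_eq_fintype_card]
  exact Set.ncard_le_card _

theorem maxMatchingSize_le {G : SimpleGraph V} {B : ℕ}
    (h : ∀ M : G.Subgraph, M.IsMatching → M.edgeSet.ncard ≤ B) : G.maxMatchingSize ≤ B :=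
  csSup_le' (by rintro _ ⟨M, hM, rfl⟩; exact h M hM)

/-- A subgraph of maximum degree `Δ` has at most `Δ + 1` times as many edges as a maximum matching
of the graph. -/
theorem card_edgeFinset_le_mul_maxMatchingSize {G H : SimpleGraph V} [DecidableRel H.Adj]
    (hle : H ≤ G) {Δ : ℕ} (hΔ : ∀ x, H.degree x ≤ Δ) :
    #H.edgeFinset ≤ (Δ + 1) * G.maxMatchingSize := by
  classical
  obtain ⟨f, hf⟩ := Pairing.exists_isMaxPairing H
  have h1 := Pairing.two_mul_card_edges_le H hΔ hf
  have hfG : Pairing.IsPairing G f := ⟨hf.1.1, fun x hx => hle (hf.1.2 x hx)⟩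
  rw [← hfG.two_mul_card_edgeSet] at h1
  have h2 : hfG.toSubgraph.edgeSet.ncard ≤ G.maxMatchingSize :=
    le_csSup G.bddAbove_matchingSize ⟨_, hfG.isMatching, rfl⟩
  calc _ ≤ (Δ + 1) * hfG.toSubgraph.edgeSet.ncard := by linarith
    _ ≤ _ := by gcongr

/-- A forest has at most as many edges inside a set of vertices as this set has elements. -/
theorem IsAcyclic.card_edgeFinset_le {W : Type*} [Fintype W] {F : SimpleGraph W}
    [Fintype F.edgeSet] (hF : F.IsAcyclic) : #F.edgeFinset ≤ Fintype.card W := by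
  classical
  rcases isEmpty_or_nonempty W with h | h
  · simp [Subsingleton.elim F ⊥]
  obtain ⟨T, hFT, -, hT⟩ := connected_top.exists_isTree_le_of_le_of_isAcyclic le_top hF
  rw [← hT.card_edgeFinset]
  exact (card_le_card (edgeFinset_mono hFT)).trans (Nat.le_succ _)

end SimpleGraph

/-! ### The edges of a stream with few later neighbouring edges -/

namespace EdgeList

variable {V : Type*} [DecidableEq V]

/-- The number of endpoints of `e` equal to `x`. -/
def hits (x : V) (e : V × V) : ℕ := (if x = e.1 then 1 else 0) + (if x = e.2 then 1 else 0)

/-- For a list of edges, newest first, the number of edges at `x` that are newer than the edge with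
index `j`. -/
def later (τ : List (V × V)) (j : ℕ) (x : V) : ℕ :=
  ∑ i : Fin τ.length, if (i : ℕ) < j then hits x τ[i] else 0

/-- The indices of the edges that have at most `α` newer edges at either endpoint. -/
def good (α : ℕ) (τ : List (V × V)) : Finset (Fin τ.length) :=
  univ.filter fun j => later τ j τ[j].1 ≤ α ∧ later τ j τ[j].2 ≤ α

/-- The underlying unordered edge. -/
def edge (τ : List (V × V)) (i : Fin τ.length) : Sym2 V := s(τ[i].1, τ[i].2)

/-- The indices of the edges at `x`. -/
def incident (τ : List (V × V)) (x : V) : Finset (Fin τ.length) := univ.filter fun i => x ∈ edge τ i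

theorem mem_incident {τ : List (V × V)} {x : V} {i : Fin τ.length} :
    i ∈ incident τ x ↔ x = τ[i].1 ∨ x = τ[i].2 := by simp [incident, edge]

/-- The sum of `hits` is what the program's counters compute; without loops no edge hits `x` twice,
so it counts edges. -/
theorem later_eq {τ : List (V × V)} (hτ : ∀ i : Fin τ.length, τ[i].1 ≠ τ[i].2)
    (j : Fin τ.length) (x : V) : later τ j x = #((incident τ x).filter (· < j)) := by
  rw [later, card_filter, incident, sum_filter]
  refine sum_congr rfl fun i _ => ?_
  have := hτ i
  have h : x ∈ edge τ i ↔ x = τ[i].1 ∨ x = τ[i].2 := by simp [edge]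
  simp only [h, hits, Fin.lt_def]
  by_cases h1 : x = τ[i].1
  · have h2 : x ≠ τ[i].2 := fun e => this (h1.symm.trans e)
    simp only [if_pos h1, if_neg h2, if_pos (Or.inl h1 : _ ∨ x = τ[i].2), add_zero]
  · by_cases h2 : x = τ[i].2
    · simp only [if_neg h1, if_pos h2, if_pos (Or.inr h2 : x = τ[i].1 ∨ _), zero_add]
    · simp only [if_neg h1, if_neg h2, if_neg (not_or.2 ⟨h1, h2⟩), add_zero, ite_self]

theorem mem_good {α : ℕ} {τ : List (V × V)} {i : Fin τ.length} :
    i ∈ good α τ ↔ ∀ x, i ∈ incident τ x → later τ i x ≤ α := by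
  simp only [mem_incident]
  simp [good]

/-- The oldest good edge at `x`, which has the largest index, sees all other good edges at `x` as
newer; there are at most `α` of these. -/
theorem card_incident_inter_good {τ : List (V × V)} (hτ : ∀ i : Fin τ.length, τ[i].1 ≠ τ[i].2)
    (α : ℕ) (x : V) : #((good α τ).filter (· ∈ incident τ x)) ≤ α + 1 := by
  rcases ((good α τ).filter (· ∈ incident τ x)).eq_empty_or_nonempty with h | h
  · simp [h]
  have hm := max'_mem _ h
  set j := ((good α τ).filter (· ∈ incident τ x)).max' h
  rw [mem_filter] at hm
  have h1 := mem_good.1 hm.1 x hm.2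
  rw [later_eq hτ] at h1
  rw [← card_erase_add_one (mem_filter.2 hm)]
  refine Nat.add_le_add_right ((card_le_card fun i hi => ?_).trans h1) 1
  rw [mem_erase, mem_filter] at hi
  exact mem_filter.2 ⟨hi.2.2, lt_of_le_of_ne (le_max' _ _ (mem_filter.2 hi.2)) hi.1⟩

/-- In a linear order, at least `min #J (α + 1)` elements of `J` have at most `α` predecessors. -/
theorem le_card_filter_rank {ι : Type*} [LinearOrder ι] (J : Finset ι) {α : ℕ} (h : α + 1 ≤ #J) :
    α + 1 ≤ #(J.filter fun i => #(J.filter (· < i)) ≤ α) := by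
  by_contra! hlt
  set B := J.filter fun i => #(J.filter (· < i)) ≤ α with hB
  have hne : (J \ B).Nonempty := by
    rw [sdiff_nonempty]
    intro hs
    have := card_le_card hs
    omega
  have hm := min'_mem _ hne
  rw [mem_sdiff] at hm
  -- All predecessors of the least element outside `B` lie in `B`, which has at most `α` elements,
  -- so this element belongs to `B` after all.
  refine hm.2 (mem_filter.2 ⟨hm.1, ?_⟩)
  refine (card_le_card (t := B) fun i hi => ?_).trans (by omega)
  rw [mem_filter] at hi
  by_contra hiB
  exact (min'_le _ i (mem_sdiff.2 ⟨hi.1, hiB⟩)).not_gt hi.2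

variable [Fintype V]

/-- All edges belong to `G` and they are distinct. -/
def IsIn (τ : List (V × V)) (G : SimpleGraph V) : Prop :=
  (τ.map fun e => s(e.1, e.2)).Nodup ∧ ∀ e ∈ τ, G.Adj e.1 e.2

omit [DecidableEq V] [Fintype V] in
theorem IsIn.edge_injective {τ : List (V × V)} {G : SimpleGraph V} (h : IsIn τ G) :
    Function.Injective (edge τ) := by
  intro i j hij
  have := h.1.injective_get (a₁ := ⟨i, by simp⟩) (a₂ := ⟨j, by simp⟩) (by simpa [edge] using hij)
  simpa [Fin.ext_iff] using this

omit [DecidableEq V] [Fintype V] in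
theorem IsIn.adj {τ : List (V × V)} {G : SimpleGraph V} (h : IsIn τ G) (i : Fin τ.length) :
    G.Adj τ[i].1 τ[i].2 := h.2 _ (List.getElem_mem _)

/-- The edge bound for maximum degree `Δ = α + 1`. The list need not exhaust `G`, so this covers
every prefix of the stream. -/
theorem card_good_le {τ : List (V × V)} {G : SimpleGraph V} (h : IsIn τ G) (α : ℕ) :
    #(good α τ) ≤ (α + 2) * G.maxMatchingSize := by
  classical
  let E : Finset (Sym2 V) := (good α τ).image (edge τ)
  obtain ⟨H, hH⟩ : ∃ H, H = SimpleGraph.fromEdgeSet (E : Set (Sym2 V)) := ⟨_, rfl⟩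
  have hEG : ∀ e ∈ E, e ∈ G.edgeSet := by
    intro e he
    obtain ⟨i, -, rfl⟩ := mem_image.1 he
    exact h.adj i
  have hHE : H.edgeFinset = E := by
    ext e
    rw [SimpleGraph.mem_edgeFinset, hH, SimpleGraph.edgeSet_fromEdgeSet]
    exact ⟨fun h => h.1, fun h => ⟨h, G.not_isDiag_of_mem_edgeSet (hEG e h)⟩⟩
  have hHG : H ≤ G := by
    rw [← SimpleGraph.edgeFinset_subset_edgeFinset, hHE]
    exact fun e he => SimpleGraph.mem_edgeFinset.2 (hEG e he)
  have hcard : #(good α τ) = #H.edgeFinset := by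
    rw [hHE, card_image_of_injective _ h.edge_injective]
  rw [hcard]
  refine SimpleGraph.card_edgeFinset_le_mul_maxMatchingSize hHG fun x => ?_
  refine le_trans ?_ (card_incident_inter_good (fun i => (h.adj i).ne) α x)
  rw [← SimpleGraph.card_incidenceFinset_eq_degree]
  refine (card_le_card (t := ((good α τ).filter (· ∈ incident τ x)).image (edge τ))
    fun e he => ?_).trans card_image_le
  rw [SimpleGraph.incidenceFinset_eq_filter, mem_filter, hHE] at he
  obtain ⟨i, hi, rfl⟩ := mem_image.1 he.1
  exact mem_image.2 ⟨i, mem_filter.2 ⟨hi, by simpa [incident] using he.2⟩, rfl⟩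

/-- The number of edges of a graph of arboricity `α` inside `S`. -/
theorem card_edges_inside_le {τ : List (V × V)} {G : SimpleGraph V} (h : IsIn τ G) {α : ℕ}
    (hG : G.HasArboricity α) (S : Finset V) :
    #(univ.filter fun i : Fin τ.length => τ[i].1 ∈ S ∧ τ[i].2 ∈ S) ≤ α * #S := by
  classical
  obtain ⟨F, hF, -, hu⟩ := hG
  have h1 : ∀ k, #((F k).edgeFinset.filter fun e => ∀ x ∈ e, x ∈ S) ≤ #S := by
    intro k
    have h2 := ((hF k).induce (S : Set V)).card_edgeFinset_le
    rw [show Fintype.card (S : Set V) = #S by simp] at h2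
    refine le_trans ?_ h2
    refine (card_le_card (t := ((F k).induce (S : Set V)).edgeFinset.image (Sym2.map Subtype.val))
      fun e he => ?_).trans card_image_le
    rw [mem_filter, SimpleGraph.mem_edgeFinset] at he
    induction e with
    | _ x y =>
      have hx : x ∈ S := he.2 x (by simp)
      have hy : y ∈ S := he.2 y (by simp)
      exact mem_image.2 ⟨s(⟨x, hx⟩, ⟨y, hy⟩), by simpa using he.1, rfl⟩
  rw [← card_image_of_injective _ h.edge_injective]
  calc _ ≤ #((univ : Finset (Fin α)).biUnion fun k =>
        (F k).edgeFinset.filter fun e => ∀ x ∈ e, x ∈ S) := by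
        refine card_le_card fun e he => ?_
        obtain ⟨i, hi, rfl⟩ := mem_image.1 he
        have hiG : edge τ i ∈ G.edgeSet := h.adj i
        rw [hu, Set.mem_iUnion] at hiG
        obtain ⟨k, hk⟩ := hiG
        rw [mem_filter] at hi
        refine mem_biUnion.2 ⟨k, mem_univ _, mem_filter.2 ⟨SimpleGraph.mem_edgeFinset.2 hk, ?_⟩⟩
        intro x hx
        rcases Sym2.mem_iff.1 hx with rfl | rfl
        · exact hi.2.1
        · exact hi.2.2
    _ ≤ ∑ k : Fin α, #S := card_biUnion_le.trans (sum_le_sum fun k _ => h1 k)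
    _ = α * #S := by simp

-- The charge of one edge `ab` in the count below, where `S` is the set of heavy vertices and `p x`
-- says that the edge is among the last ones at `x`. Light endpoints satisfy `p` automatically, so
-- an edge with one heavy endpoint is charged only if it is good; a charge of two requires both
-- endpoints in `S` and is paid by both terms.
omit [Fintype V] in
theorem card_filter_pair_le (S : Finset V) {a b : V} (hab : a ≠ b) (p : V → Prop)
    [DecidablePred p] (ha : a ∉ S → p a) (hb : b ∉ S → p b) :
    #(S.filter fun x => (x = a ∨ x = b) ∧ p x) ≤
      (if (p a ∧ p b) ∧ ¬ (a ∉ S ∧ b ∉ S) then 1 else 0) + (if a ∈ S ∧ b ∈ S then 1 else 0) := by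
  have : (S.filter fun x => (x = a ∨ x = b) ∧ p x) =
      ({a, b} : Finset V).filter fun x => x ∈ S ∧ p x := by
    ext x
    simp only [mem_filter, mem_insert, mem_singleton]
    tauto
  rw [this, card_filter, sum_pair hab]
  by_cases h1 : a ∈ S <;> by_cases h2 : b ∈ S <;> by_cases h3 : p a <;> by_cases h4 : p b <;>
    simp_all

/-- Double counting of the pairs of a heavy vertex and one of its last `α + 1` edges gives `(α + 1)
#S ≤ #(good \ LL) + α #S`, where `LL` are the edges with two light endpoints. So the good edges
outside `LL` pay for the matching edges meeting `S`, and `LL`, all good, pays for the rest. -/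
theorem maxMatchingSize_le_card_good {τ : List (V × V)} {G : SimpleGraph V} (h : IsIn τ G)
    (hall : ∀ e ∈ G.edgeSet, ∃ i, edge τ i = e) {α : ℕ} (hG : G.HasArboricity α) :
    G.maxMatchingSize ≤ #(good α τ) := by
  classical
  have hne : ∀ i : Fin τ.length, τ[i].1 ≠ τ[i].2 := fun i => (h.adj i).ne
  let S : Finset V := univ.filter fun x => α + 1 ≤ #(incident τ x)
  let B : V → Finset (Fin τ.length) := fun x => (incident τ x).filter fun i => later τ i x ≤ α
  let LL : Finset (Fin τ.length) := univ.filter fun i => τ[i].1 ∉ S ∧ τ[i].2 ∉ S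
  have hB : ∀ x ∈ S, α + 1 ≤ #(B x) := fun x hx => by
    have := le_card_filter_rank (incident τ x) (mem_filter.1 hx).2
    simpa only [B, later_eq hne] using this
  have hlight : ∀ x ∉ S, ∀ i ∈ incident τ x, later τ i x ≤ α := fun x hx i _ => by
    have hx : #(incident τ x) ≤ α := by
      by_contra hc
      exact hx (mem_filter.2 ⟨mem_univ _, by omega⟩)
    rw [later_eq hne]
    exact (card_le_card (filter_subset _ _)).trans hx
  have hLL : LL ⊆ good α τ := fun i hi => by
    have hi := (mem_filter.1 hi).2
    refine mem_good.2 fun x hx => ?_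
    have hx' := hx
    rw [mem_incident] at hx'
    rcases hx' with rfl | rfl
    · exact hlight _ hi.1 _ hx
    · exact hlight _ hi.2 _ hx
  have hcount : ∑ x ∈ S, #(B x) ≤ #(good α τ \ LL) +
      #(univ.filter fun i : Fin τ.length => τ[i].1 ∈ S ∧ τ[i].2 ∈ S) := by
    have h1 : ∑ x ∈ S, #(B x) = ∑ i, #(S.filter fun x => i ∈ B x) := by
      have := sum_card_bipartiteAbove_eq_sum_card_bipartiteBelow (s := S)
        (t := (univ : Finset (Fin τ.length))) (fun x i => i ∈ B x)
      simpa [bipartiteAbove, bipartiteBelow] using this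
    rw [h1, ← filter_mem_eq_inter (s := univ) (t := good α τ \ LL) |>.trans (univ_inter _),
      card_filter, card_filter, ← sum_add_distrib]
    refine sum_le_sum fun i _ => ?_
    have hBi : ∀ x, i ∈ B x ↔ (x = τ[i].1 ∨ x = τ[i].2) ∧ later τ i x ≤ α := fun x => by
      rw [← mem_incident]; simp [B]
    have hg : i ∈ good α τ ↔ later τ i τ[i].1 ≤ α ∧ later τ i τ[i].2 ≤ α := by simp [good]
    have hl : i ∈ LL ↔ τ[i].1 ∉ S ∧ τ[i].2 ∉ S := by simp [LL]
    simp only [mem_sdiff, hg, hl, hBi]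
    exact card_filter_pair_le S (hne i) (fun x => later τ i x ≤ α)
      (fun hS => hlight _ hS i (mem_incident.2 (Or.inl rfl)))
      (fun hS => hlight _ hS i (mem_incident.2 (Or.inr rfl)))
  have hSle : #S ≤ #(good α τ \ LL) := by
    have h1 : #S * (α + 1) ≤ ∑ x ∈ S, #(B x) := card_nsmul_le_sum _ _ _ hB
    have h2 := card_edges_inside_le h hG S
    nlinarith
  refine SimpleGraph.maxMatchingSize_le fun M hM => ?_
  have hgood : #(good α τ) = #(good α τ \ LL) + #LL := by
    rw [card_sdiff_add_card_eq_card hLL]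
  have hMt : M.edgeSet = M.edgeSet.toFinset := by simp
  rw [hgood, hMt, Set.ncard_coe_finset]
  refine le_trans (card_le_card (t := (M.edgeSet.toFinset.filter fun e => ∃ x ∈ e, x ∈ S) ∪
    LL.image (edge τ)) fun e he => ?_) ((card_union_le _ _).trans (Nat.add_le_add ?_ card_image_le))
  · rw [mem_union, mem_filter]
    by_cases hx : ∃ x ∈ e, x ∈ S
    · exact Or.inl ⟨he, hx⟩
    · right
      push Not at hx
      obtain ⟨i, rfl⟩ := hall e (M.edgeSet_subset (Set.mem_toFinset.1 he))
      exact mem_image.2 ⟨i, mem_filter.2 ⟨mem_univ _, hx _ (by simp [edge]), hx _ (by simp [edge])⟩,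
        rfl⟩
  · refine le_trans ?_ hSle
    refine card_le_card_of_forall_subsingleton (fun e x => x ∈ e)
      (fun e he => (mem_filter.1 he).2.imp fun x hx => ⟨hx.2, hx.1⟩) fun x _ => ?_
    rintro e ⟨he, hxe⟩ e' ⟨he', hxe'⟩
    have he1 := Set.mem_toFinset.1 (mem_filter.1 he).1
    have he2 := Set.mem_toFinset.1 (mem_filter.1 he').1
    obtain ⟨y, rfl⟩ := Sym2.mem_iff_exists.1 hxe
    obtain ⟨z, rfl⟩ := Sym2.mem_iff_exists.1 hxe'
    have hyz : y = z := hM.eq_of_adj_left he1 he2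
    rw [hyz]

end EdgeList

/-! ### Concentration of the size of a random sample -/

namespace Sampling

variable {m P : ℕ}

/-- The number of elements of `A` that are sampled at threshold `q`. -/
def sampleCount (A : Finset (Fin m)) (q : ℕ) (U : Fin m → Fin P) : ℕ :=
  #(A.filter fun i => (U i : ℕ) < q)

theorem card_filter_lt {q : ℕ} (hq : q ≤ P) : #(univ.filter fun u : Fin P => (u : ℕ) < q) = q := by
  simp [Fin.card_filter_val_lt, hq]

/-- The moment generating function, multiplied by the number `P ^ m` of outcomes; by independence it
factors over the coordinates. -/
theorem sum_exp_sampleCount (A : Finset (Fin m)) {q : ℕ} (hq : q ≤ P) (t : ℝ) :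
    ∑ U : Fin m → Fin P, Real.exp (t * sampleCount A q U) =
      (P : ℝ) ^ (m - #A) * (P + q * (Real.exp t - 1)) ^ #A := by
  have h1 : ∀ U : Fin m → Fin P, Real.exp (t * sampleCount A q U) =
      ∏ i, if i ∈ A ∧ (U i : ℕ) < q then Real.exp t else 1 := fun U => by
    rw [prod_ite, prod_const_one, mul_one, prod_const, ← Real.exp_nat_mul, mul_comm, sampleCount]
    congr 3
    rw [← filter_filter, filter_univ_mem]
  simp_rw [h1]
  rw [← Fintype.piFinset_univ, ← prod_univ_sum (fun _ => univ)
    (fun i (u : Fin P) => if i ∈ A ∧ (u : ℕ) < q then Real.exp t else 1)]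
  have h2 : ∀ i : Fin m, ∑ u : Fin P, (if i ∈ A ∧ (u : ℕ) < q then Real.exp t else 1) =
      if i ∈ A then P + q * (Real.exp t - 1) else (P : ℝ) := fun i => by
    by_cases hi : i ∈ A
    · have h3 : ∀ u : Fin P, (if (u : ℕ) < q then Real.exp t else 1) =
          1 + if (u : ℕ) < q then Real.exp t - 1 else 0 := fun u => by split_ifs <;> ring
      simp only [hi, true_and, if_true, h3, sum_add_distrib, ← sum_filter, sum_const,
        card_filter_lt hq, card_univ, Fintype.card_fin, nsmul_eq_mul, mul_one]
    · simp [hi]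
  simp_rw [h2]
  rw [prod_ite, prod_const, prod_const, filter_univ_mem, mul_comm, filter_not, filter_univ_mem,
    ← compl_eq_univ_sdiff, card_compl, Fintype.card_fin]

/-- Uses `exp t - 1 ≤ t + t ^ 2` for `|t| ≤ 1`, then `1 + y ≤ exp y` in each factor. -/
theorem sum_exp_sampleCount_le (A : Finset (Fin m)) {q : ℕ} (hq : q ≤ P) (hP : 0 < P) {t : ℝ}
    (ht : |t| ≤ 1) :
    ∑ U : Fin m → Fin P, Real.exp (t * sampleCount A q U) ≤
      (P : ℝ) ^ m * Real.exp (q / P * #A * (t + t ^ 2)) := by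
  rw [sum_exp_sampleCount A hq]
  have hP' : (0 : ℝ) < P := by exact_mod_cast hP
  have hA : #A ≤ m := by simpa using card_le_univ A
  have he : Real.exp t - 1 ≤ t + t ^ 2 := by
    have := (abs_le.1 (Real.abs_exp_sub_one_sub_id_le ht)).2
    linarith
  have h0 : (0 : ℝ) ≤ P + q * (Real.exp t - 1) := by
    have : (q : ℝ) ≤ P := by exact_mod_cast hq
    have : (0 : ℝ) ≤ q := Nat.cast_nonneg q
    nlinarith [Real.exp_pos t]
  have h1 : (P + q * (Real.exp t - 1) : ℝ) ≤ P * Real.exp (q / P * (t + t ^ 2)) := by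
    calc (P + q * (Real.exp t - 1) : ℝ) ≤ P + q * (t + t ^ 2) := by gcongr
      _ = P * (q / P * (t + t ^ 2) + 1) := by field_simp; ring
      _ ≤ _ := by gcongr; exact Real.add_one_le_exp _
  calc (P : ℝ) ^ (m - #A) * (P + q * (Real.exp t - 1)) ^ #A
      ≤ (P : ℝ) ^ (m - #A) * (P * Real.exp (q / P * (t + t ^ 2))) ^ #A := by gcongr
    _ = (P : ℝ) ^ (m - #A + #A) * Real.exp (q / P * (t + t ^ 2)) ^ #A := by
        rw [mul_pow, pow_add, mul_assoc]
    _ = _ := by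
        rw [Nat.sub_add_cancel hA, ← Real.exp_nat_mul]
        ring_nf

/-- One-sided Chernoff bound; the sign of `t` selects the side. -/
theorem card_tail_le_of_abs (A : Finset (Fin m)) {q : ℕ} (hq : q ≤ P) (hP : 0 < P) {E δ t : ℝ}
    (hE : (#A : ℝ) ≤ E) (hδ : δ ≤ 1) (ht : |t| = δ / 2) :
    (#(univ.filter fun U : Fin m → Fin P =>
      |t| * (δ * (q / P * E)) ≤ t * (sampleCount A q U - q / P * #A)) : ℝ) ≤
      (P : ℝ) ^ m * Real.exp (-(q / P * E * δ ^ 2 / 4)) := by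
  set p : ℝ := q / P
  have hp : 0 ≤ p := by positivity
  set B := univ.filter fun U : Fin m → Fin P =>
      |t| * (δ * (p * E)) ≤ t * (sampleCount A q U - p * #A)
  have hsum := sum_exp_sampleCount_le (P := P) A hq hP (t := t) (by linarith)
  have h1 : #B * Real.exp (t * (p * #A) + |t| * (δ * (p * E))) ≤
      ∑ U : Fin m → Fin P, Real.exp (t * sampleCount A q U) := by
    rw [← nsmul_eq_mul]
    refine (card_nsmul_le_sum B (fun U => Real.exp (t * sampleCount A q U)) _ fun U hU => ?_).trans
      (sum_le_sum_of_subset_of_nonneg (subset_univ _) fun _ _ _ => (Real.exp_pos _).le)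
    have := (mem_filter.1 hU).2
    exact Real.exp_le_exp.2 (by linarith)
  have h2 := h1.trans hsum
  rw [← le_div_iff₀ (Real.exp_pos _), mul_div_assoc, ← Real.exp_sub] at h2
  -- For `t = ±δ/2` and `p = q / P` the exponent is `p #A δ²/4 - p E δ²/2`, at most `-p E δ²/4`
  -- because `#A ≤ E`. The deviation is measured against `E`, not `#A`, so small sets cause no loss.
  refine h2.trans (mul_le_mul_of_nonneg_left (Real.exp_le_exp.2 ?_) (by positivity))
  have ht2 : t ^ 2 = δ ^ 2 / 4 := by rw [← sq_abs, ht]; ring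
  have h3 : p * #A ≤ p * E := by gcongr
  rw [ht]
  change p * #A * (t + t ^ 2) - _ ≤ _
  rw [ht2]
  nlinarith [mul_le_mul_of_nonneg_right h3 (sq_nonneg δ)]

theorem card_tail_le (A : Finset (Fin m)) {q : ℕ} (hq : q ≤ P) (hP : 0 < P) {E δ : ℝ}
    (hE : (#A : ℝ) ≤ E) (hδ : δ ≤ 1) (hδ0 : 0 < δ) :
    (#(univ.filter fun U : Fin m → Fin P =>
      δ * (q / P * E) < |(sampleCount A q U : ℝ) - q / P * #A|) : ℝ) ≤
      2 * ((P : ℝ) ^ m * Real.exp (-(q / P * E * δ ^ 2 / 4))) := by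
  have hpos : |δ / 2| = δ / 2 := abs_of_pos (by positivity)
  have hneg : |-(δ / 2)| = δ / 2 := by rw [abs_neg, hpos]
  have h1 := card_tail_le_of_abs A hq hP hE hδ hpos
  have h2 := card_tail_le_of_abs A hq hP hE hδ hneg
  rw [two_mul]
  refine le_trans ?_ (add_le_add h1 h2)
  norm_cast
  refine le_trans (card_le_card fun U hU => ?_) (card_union_le _ _)
  have := (mem_filter.1 hU).2
  rw [mem_union, mem_filter, mem_filter, hpos, hneg]
  have hd : 0 < δ / 2 := by positivity
  rcases lt_abs.1 this with h | h
  · exact Or.inl ⟨mem_univ _, by gcongr⟩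
  · refine Or.inr ⟨mem_univ _, ?_⟩
    rw [neg_mul, ← mul_neg]
    gcongr

theorem le_prob_map_uniform {Ω X : Type*} [Fintype Ω] [Nonempty Ω] [DecidableEq Ω] (f : Ω → X)
    (S : Set X) (bad : Finset Ω) (hbad : ∀ ω ∉ bad, f ω ∈ S) :
    1 - (#bad : ℝ) / Fintype.card Ω ≤ Streaming.prob ((PMF.uniformOfFintype Ω).map f) S := by
  classical
  rw [Streaming.prob, PMF.toOuterMeasure_map_apply, PMF.toOuterMeasure_uniformOfFintype_apply,
    ENNReal.toReal_div, ENNReal.toReal_natCast, ENNReal.toReal_natCast]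
  have hpos : (0 : ℝ) < Fintype.card Ω := by exact_mod_cast Fintype.card_pos
  rw [sub_le_iff_le_add, ← add_div, le_div_iff₀ hpos, one_mul, ← Nat.cast_add]
  rw [← Set.toFinset_card, ← card_univ]
  exact_mod_cast (card_le_card fun ω _ => by
    by_cases h : ω ∈ bad
    · exact mem_union_right _ h
    · exact mem_union_left _ (by simpa using hbad ω h)).trans (card_union_le _ _)

end Sampling

/-! ### Deterministic commands -/

namespace Streaming

variable {w b : ℕ}

theorem Memory.read_lt (m : Memory w b) (a : ℕ) : m.read a < 2 ^ b := by
  unfold Memory.read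
  split_ifs
  · exact Fin.is_lt _
  · exact Nat.two_pow_pos b

theorem Memory.read_write (m : Memory w b) {a v : ℕ} (ha : a < w) (hv : v < 2 ^ b) (x : ℕ) :
    (m.write a v).read x = if x = a then v else m.read x := by
  unfold Memory.write Memory.read
  rw [dif_pos ha]
  split_ifs with h1 h2 h2
  · subst h2
    simp [Nat.mod_eq_of_lt hv]
  · rw [Function.update_of_ne (by simpa [Fin.ext_iff] using h2)]
  · omega
  · rfl

/-- The effect of a command without coin tosses. -/
def Cmd.det (params item : List ℕ) : Cmd → Memory w b → Memory w b
  | .skip, m => m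
  | .store a e, m => Memory.write m (a.eval params item m) (e.eval params item m)
  | .flip _, m => m
  | .seq s t, m => t.det params item (s.det params item m)
  | .ite e s t, m =>
      if e.eval params item m ≠ 0 then s.det params item m else t.det params item m
  | .loop e s, m => (s.det params item)^[e.eval params item m % 2 ^ b] m

/-- The command tosses no coins. -/
def Cmd.IsDet : Cmd → Prop
  | .skip => True
  | .store _ _ => True
  | .flip _ => False
  | .seq s t => s.IsDet ∧ t.IsDet
  | .ite _ s t => s.IsDet ∧ t.IsDet
  | .loop _ s => s.IsDet

theorem Cmd.exec_of_isDet (params item : List ℕ) {c : Cmd} (hc : c.IsDet) (m : Memory w b) :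
    c.exec params item m = PMF.pure (c.det params item m) := by
  induction c generalizing m with
  | skip => rfl
  | store a e => rfl
  | flip a => exact hc.elim
  | seq s t hs ht =>
    simp only [Cmd.exec, Cmd.det]
    rw [hs hc.1, PMF.pure_bind, ht hc.2]
  | ite e s t hs ht =>
    simp only [Cmd.exec, Cmd.det]
    rw [hs hc.1, ht hc.2]
    split_ifs <;> rfl
  | loop e s hs =>
    simp only [Cmd.exec, Cmd.det]
    generalize e.eval params item m % 2 ^ b = k
    induction k with
    | zero => rfl
    | succ k ih => rw [Function.iterate_succ_apply', ih, PMF.pure_bind, hs hc,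
        Function.iterate_succ_apply']

end Streaming

/-- The invariant rule for loops: the invariant may depend on the iteration number, and the step may
use that it is below the total. -/
theorem Function.iterate_induction_le {X : Type*} (f : X → X) (I : ℕ → X → Prop) {k : ℕ} {x : X}
    (h0 : I 0 x) (hs : ∀ j < k, ∀ y, I j y → I (j + 1) (f y)) : I k (f^[k] x) := by
  induction k with
  | zero => exact h0
  | succ k ih =>
    rw [Function.iterate_succ_apply']
    exact hs k (Nat.lt_succ_self k) _ (ih fun j hj => hs j (by omega))

/-! ### The program -/

namespace Sketch

open Streaming

/-- Registers: number of stored edges, threshold, best estimate, number of random bits per edge,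
size of the range of the random numbers, read and write positions, random number, coin. -/
abbrev reg (a : ℕ) : Expr := .cell (.lit a)
abbrev size : Expr := reg 0
abbrev threshold : Expr := reg 1
abbrev best : Expr := reg 2
abbrev bits : Expr := reg 3
abbrev range : Expr := reg 4
abbrev src : Expr := reg 5
abbrev dst : Expr := reg 6
abbrev random : Expr := reg 7
abbrev coin : Expr := reg 8

/-- Address of field `f` of the `i`-th stored edge; the fields are the two endpoints, the numbers
of later edges at them, and the random number of the edge. -/
abbrev slot (i : Expr) (f : ℕ) : Expr := .add (.lit (10 + f)) (.mul (.lit 5) i)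
abbrev field (i : Expr) (f : ℕ) : Expr := .cell (slot i f)
abbrev set (a : ℕ) (e : Expr) : Cmd := .store (.lit a) e
abbrev incr (a : ℕ) : Cmd := set a (.add (reg a) (.lit 1))

def bump (f : ℕ) : Cmd :=
  .store (slot src (2 + f)) (.add (field src (2 + f))
    (.add (.eq (field src f) (.item 0)) (.eq (field src f) (.item 1))))

def bumpAll : Cmd :=
  .seq (set 5 (.lit 0)) (.loop size (.seq (bump 0) (.seq (bump 1) (incr 5))))

def append : Cmd :=
  .seq (.store (slot size 0) (.item 0)) (.seq (.store (slot size 1) (.item 1))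
    (.seq (.store (slot size 2) (.lit 0)) (.seq (.store (slot size 3) (.lit 0))
      (.seq (.store (slot size 4) random) (incr 0)))))

/-- Products serve as conjunctions, and `α + 1` turns the strict comparison into `≤ α`. -/
def keepTest : Expr :=
  .mul (.lt (field src 2) (.add (.param 1) (.lit 1)))
    (.mul (.lt (field src 3) (.add (.param 1) (.lit 1))) (.lt (field src 4) threshold))

def copy (f : ℕ) : Cmd := .store (slot dst f) (field src f)

def copyAll : Cmd :=
  .seq (copy 0) (.seq (copy 1) (.seq (copy 2) (.seq (copy 3) (.seq (copy 4) (incr 6)))))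

/-- In-place compaction: the write position never overtakes the read position. -/
def prune : Cmd :=
  .seq (set 5 (.lit 0)) (.seq (set 6 (.lit 0)) (.seq
    (.loop size (.seq (.ite keepTest copyAll .skip) (incr 5))) (set 0 dst)))

/-- With parameter 2 equal to `⌈1/ε⌉` and `O(log n)` random bits this is of order `ε⁻² log n`. -/
def capacity (K : ℕ) : Expr := .mul (.lit K) (.mul (.mul (.param 2) (.param 2)) bits)

/-- One more round than there are random bits, enough to bring the threshold from `2 ^ M` to zero if
need be. -/
def shrink (K : ℕ) : Cmd :=
  .loop (.add bits (.lit 1))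
    (.ite (.lt (capacity K) size) (.seq (set 1 (.div threshold (.lit 2))) prune) .skip)

def estimate : Expr := .div (.mul size range) threshold

def record : Cmd := .ite (.lt best estimate) (set 2 estimate) .skip

def draw : Cmd :=
  .seq (set 7 (.lit 0)) (.loop bits (.seq (.flip (.lit 8))
    (set 7 (.add (.mul (.lit 2) random) coin))))

def absorb (K : ℕ) : Cmd := .seq bumpAll (.seq append (.seq prune (.seq (shrink K) record)))

/-- Doubles the range until it reaches `n²`, hence at least the length of any edge stream; `2 n`
rounds suffice. -/
def setup : Cmd :=
  .seq (set 4 (.lit 1)) (.seq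
    (.loop (.mul (.lit 2) (.param 0)) (.ite (.lt range (.mul (.param 0) (.param 0)))
      (.seq (set 4 (.mul (.lit 2) range)) (incr 3)) .skip)) (set 1 range))

/-- The streaming program that estimates the size of a maximum matching. -/
def program (K : ℕ) : Program where
  setup := setup
  update := .seq draw (absorb K)
  -- The factor `1 + 1/(4k)` turns a two-sided estimate into one that is never below the peak.
  output := .div (.mul best (.add (.mul (.lit 4) (.param 2)) (.lit 1))) (.mul (.lit 4) (.param 2))

/-! ### The abstract algorithm -/

variable {n : ℕ}

/-- A stored edge. -/
structure Entry (n : ℕ) where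
  u : Fin n
  v : Fin n
  cu : ℕ
  cv : ℕ
  r : ℕ

/-- A stream item together with its random number. -/
abbrev Draw (n : ℕ) : Type := (Fin n × Fin n) × ℕ

def Entry.bump (x : Fin n × Fin n) (e : Entry n) : Entry n :=
  { e with cu := e.cu + EdgeList.hits e.u x, cv := e.cv + EdgeList.hits e.v x }

def Entry.new (x : Draw n) : Entry n := ⟨x.1.1, x.1.2, 0, 0, x.2⟩

def Entry.keep (α q : ℕ) (e : Entry n) : Bool := decide (e.cu ≤ α ∧ e.cv ≤ α ∧ e.r < q)

/-- All edges of the history (newest first) with their counters, oldest first. -/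
def track : List (Draw n) → List (Entry n)
  | [] => []
  | x :: h => (track h).map (Entry.bump x.1) ++ [Entry.new x]

/-- The edges that are stored at threshold `q`. -/
def live (α : ℕ) (h : List (Draw n)) (q : ℕ) : List (Entry n) := (track h).filter (Entry.keep α q)

def halve (α T : ℕ) (h : List (Draw n)) (q : ℕ) : ℕ :=
  if T < (live α h q).length then q / 2 else q

/-- The threshold is carried over from the older history and only ever decreases. -/
def finalThreshold (α T M : ℕ) : List (Draw n) → ℕ
  | [] => 2 ^ M
  | x :: h => (halve α T (x :: h))^[M + 1] (finalThreshold α T M h)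

def finalBest (α T M : ℕ) : List (Draw n) → ℕ
  | [] => 0
  | x :: h =>
    let q := finalThreshold α T M (x :: h)
    max (finalBest α T M h) ((live α (x :: h) q).length * 2 ^ M / q)

theorem Entry.keep_of_keep_bump {α q : ℕ} {x : Fin n × Fin n} {e : Entry n}
    (h : (e.bump x).keep α q) : e.keep α q := by
  have h := of_decide_eq_true h
  exact decide_eq_true ⟨(Nat.le_add_right _ _).trans h.1, (Nat.le_add_right _ _).trans h.2.1, h.2.2⟩

/-- Counters never decrease, so an edge discarded earlier would also fail the test now: updating the
stored list gives the same result as filtering the full history. -/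
theorem live_cons (α q : ℕ) (x : Draw n) (h : List (Draw n)) :
    ((live α h q).map (Entry.bump x.1) ++ [Entry.new x]).filter (Entry.keep α q) =
      live α (x :: h) q := by
  rw [live, live, track, List.filter_append, List.filter_append, List.filter_map, List.filter_map,
    List.filter_filter]
  congr 2
  refine List.filter_congr fun e _ => ?_
  simp only [Function.comp]
  by_cases h : Entry.keep α q (e.bump x.1) = true
  · simp [h, Entry.keep_of_keep_bump h]
  · simp [h]

theorem filter_live (α : ℕ) (h : List (Draw n)) {q q' : ℕ} (hq : q' ≤ q) :
    (live α h q).filter (Entry.keep α q') = live α h q' := by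
  rw [live, live, List.filter_filter]
  refine List.filter_congr fun e _ => ?_
  simp only [Entry.keep]
  rw [← Bool.decide_and, decide_eq_decide]
  omega

theorem length_track (h : List (Draw n)) : (track h).length = h.length := by
  induction h with
  | nil => rfl
  | cons x h ih => simp [track, ih]

theorem length_live_le (α : ℕ) (h : List (Draw n)) (q : ℕ) : (live α h q).length ≤ h.length :=
  (List.length_filter_le _ _).trans (length_track h).le

theorem live_zero (α : ℕ) (h : List (Draw n)) : live α h 0 = [] := by
  rw [live, List.filter_eq_nil_iff]
  simp [Entry.keep]

/-- A crude bound, needed only to see that counters fit into a word. -/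
theorem counters_le (h : List (Draw n)) :
    ∀ e ∈ track h, e.cu ≤ 2 * h.length ∧ e.cv ≤ 2 * h.length := by
  have hh : ∀ (y : Fin n) (x : Fin n × Fin n), EdgeList.hits y x ≤ 2 := fun y x => by
    unfold EdgeList.hits
    split_ifs <;> simp
  induction h with
  | nil => simp [track]
  | cons x h ih =>
    intro e he
    rw [track, List.mem_append, List.mem_map, List.mem_singleton] at he
    rw [List.length_cons]
    rcases he with ⟨e, he, rfl⟩ | rfl
    · have h1 := ih e he
      have h2 := hh e.u x.1
      have h3 := hh e.v x.1
      simp only [Entry.bump]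
      omega
    · simp [Entry.new]

theorem halve_le (α T : ℕ) (h : List (Draw n)) (q : ℕ) : halve α T h q ≤ q := by
  unfold halve
  split_ifs
  · exact Nat.div_le_self _ _
  · exact le_rfl

theorem finalThreshold_le (α T M : ℕ) (h : List (Draw n)) : finalThreshold α T M h ≤ 2 ^ M := by
  induction h with
  | nil => exact le_rfl
  | cons x h ih =>
    exact Function.iterate_induction_le _ (fun _ q => q ≤ 2 ^ M) ih
      fun _ _ q hq => (halve_le _ _ _ q).trans hq

/-- The space bound holds for every outcome of the coins: while overflow persists, `j` rounds leave
`q * 2 ^ j ≤ 2 ^ M`, so after `M + 1` rounds the threshold is zero and nothing is stored. -/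
theorem length_live_finalThreshold_le (α T M : ℕ) (h : List (Draw n)) :
    (live α h (finalThreshold α T M h)).length ≤ T := by
  cases h with
  | nil => simp [live, track]
  | cons x h =>
    have := Function.iterate_induction_le (halve α T (x :: h))
      (fun j q => (live α (x :: h) q).length ≤ T ∨ q * 2 ^ j ≤ 2 ^ M) (k := M + 1)
      (Or.inr (by simpa using finalThreshold_le α T M h)) fun j _ q hq => by
        unfold halve
        split_ifs with hT
        · refine Or.inr ?_
          calc q / 2 * 2 ^ (j + 1) = q / 2 * 2 * 2 ^ j := by ring
            _ ≤ q * 2 ^ j := Nat.mul_le_mul_right _ (Nat.div_mul_le_self q 2)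
            _ ≤ 2 ^ M := hq.resolve_left (by omega)
        · exact Or.inl (by omega)
    rcases this with h1 | h1
    · exact h1
    · rw [finalThreshold]
      have hz : (halve α T (x :: h))^[M + 1] (finalThreshold α T M h) = 0 := by
        by_contra hne
        have h2 : 1 * 2 ^ (M + 1) ≤ _ := (Nat.mul_le_mul_right _ (Nat.pos_of_ne_zero hne)).trans h1
        rw [one_mul, pow_succ] at h2
        have := Nat.two_pow_pos M
        omega
      rw [hz, live_zero]
      simp

end Sketch

namespace Sketch

open Streaming

/-! ### Correctness of the deterministic part -/

variable {n w b : ℕ}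

/-- The `j`-th slot of the memory contains `e`. -/
structure Stored (m : Memory w b) (j : ℕ) (e : Entry n) : Prop where
  u : m.read (10 + 5 * j) = e.u
  v : m.read (11 + 5 * j) = e.v
  cu : m.read (12 + 5 * j) = e.cu
  cv : m.read (13 + 5 * j) = e.cv
  r : m.read (14 + 5 * j) = e.r

theorem Stored.congr {m m' : Memory w b} {j : ℕ} {e : Entry n} (h : Stored m j e)
    (hm : ∀ a, 10 + 5 * j ≤ a → a < 15 + 5 * j → m'.read a = m.read a) : Stored m' j e :=
  ⟨(hm _ (by omega) (by omega)).trans h.u, (hm _ (by omega) (by omega)).trans h.v,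
    (hm _ (by omega) (by omega)).trans h.cu, (hm _ (by omega) (by omega)).trans h.cv,
    (hm _ (by omega) (by omega)).trans h.r⟩

/-- The memory stores the list `es`, with threshold `q`, estimate `B` and `M` random bits. -/
structure Holds (m : Memory w b) (q B M : ℕ) (es : List (Entry n)) : Prop where
  size : m.read 0 = es.length
  threshold : m.read 1 = q
  best : m.read 2 = B
  bits : m.read 3 = M
  range : m.read 4 = 2 ^ M
  stored : ∀ j e, es[j]? = some e → Stored m j e

variable {params : List ℕ} {x : Fin n × Fin n}

abbrev item (x : Fin n × Fin n) : List ℕ := [(x.1 : ℕ), (x.2 : ℕ)]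

theorem det_bumpBody {m : Memory w b} {k : ℕ} {e : Entry n} (hk : m.read 5 = k)
    (he : Stored m k e) (hw : 15 + 5 * k ≤ w) (hcu : e.cu + 2 < 2 ^ b) (hcv : e.cv + 2 < 2 ^ b)
    (hkb : k + 1 < 2 ^ b) :
    let m' := (Cmd.seq (bump 0) (.seq (bump 1) (incr 5))).det params (item x) m
    m'.read 5 = k + 1 ∧ Stored m' k (e.bump x) ∧
      ∀ a, a ≠ 5 → (a < 10 + 5 * k ∨ 15 + 5 * k ≤ a) → m'.read a = m.read a := by
  intro m'
  have hh : ∀ y : Fin n, EdgeList.hits y x =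
      (if (y : ℕ) = x.1 then 1 else 0) + if (y : ℕ) = x.2 then 1 else 0 := fun y => by
    simp [EdgeList.hits, Fin.ext_iff]
  have hh2 : ∀ y : Fin n, EdgeList.hits y x ≤ 2 := fun y => by
    rw [hh]; split_ifs <;> simp
  have h1 := hh2 e.u
  have h2 := hh2 e.v
  let m1 := m.write (12 + 5 * k) (e.cu + EdgeList.hits e.u x)
  have e1 : (bump 0).det params (item x) m = m1 := by
    simp only [bump, Cmd.det, Expr.eval, hk, Nat.add_zero, he.cu, he.u, m1, hh]
    rfl
  have r1 := m.read_write (a := 12 + 5 * k) (v := e.cu + EdgeList.hits e.u x) (by omega) (by omega)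
  let m2 := m1.write (13 + 5 * k) (e.cv + EdgeList.hits e.v x)
  have e2 : (bump 1).det params (item x) m1 = m2 := by
    have a1 : m1.read 5 = k := by rw [r1, if_neg (by omega), hk]
    have a2 : m1.read (11 + 5 * k) = e.v := by rw [r1, if_neg (by omega), he.v]
    have a3 : m1.read (13 + 5 * k) = e.cv := by rw [r1, if_neg (by omega), he.cv]
    simp only [bump, Cmd.det, Expr.eval, a1, a2, a3, m2, hh]
    rfl
  have r2 := m1.read_write (a := 13 + 5 * k) (v := e.cv + EdgeList.hits e.v x) (by omega) (by omega)
  have e3 : m' = m2.write 5 (k + 1) := by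
    have a1 : m2.read 5 = k := by rw [r2, if_neg (by omega), r1, if_neg (by omega), hk]
    change (incr 5).det params (item x) ((bump 1).det params (item x)
      ((bump 0).det params (item x) m)) = _
    rw [e1, e2]
    simp only [Cmd.det, Expr.eval, a1]
  have r3 := m2.read_write (a := 5) (v := k + 1) (by omega) hkb
  have hr : ∀ a, m'.read a = if a = 5 then k + 1 else if a = 13 + 5 * k then
      e.cv + EdgeList.hits e.v x else if a = 12 + 5 * k then e.cu + EdgeList.hits e.u x
      else m.read a := fun a => by rw [e3, r3, r2, r1]
  refine ⟨by rw [hr, if_pos rfl], ⟨?_, ?_, ?_, ?_, ?_⟩, fun a ha ha' => ?_⟩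
  · rw [hr, if_neg (by omega), if_neg (by omega), if_neg (by omega)]; exact he.u
  · rw [hr, if_neg (by omega), if_neg (by omega), if_neg (by omega)]; exact he.v
  · rw [hr, if_neg (by omega), if_neg (by omega), if_pos rfl]; rfl
  · rw [hr, if_neg (by omega), if_pos rfl]; rfl
  · rw [hr, if_neg (by omega), if_neg (by omega), if_neg (by omega)]; exact he.r
  · rw [hr, if_neg (by omega), if_neg (by omega), if_neg (by omega)]

theorem Holds.bumpAll {m : Memory w b} {q B M : ℕ} {es : List (Entry n)} (h : Holds m q B M es)
    (hw : 15 + 5 * es.length ≤ w) (hb : es.length < 2 ^ b)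
    (hes : ∀ e ∈ es, e.cu + 2 < 2 ^ b ∧ e.cv + 2 < 2 ^ b) :
    Holds (Sketch.bumpAll.det params (item x) m) q B M (es.map (Entry.bump x)) ∧
      (Sketch.bumpAll.det params (item x) m).read 7 = m.read 7 := by
  let m0 := m.write 5 0
  have r0 := m.read_write (a := 5) (v := 0) (by omega) (by omega)
  have hsize : Sketch.size.eval params (item x) m0 % 2 ^ b = es.length := by
    simp only [Expr.eval, m0]
    rw [r0, if_neg (by omega), h.size, Nat.mod_eq_of_lt hb]
  have heq : Sketch.bumpAll.det params (item x) m =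
      ((Cmd.seq (bump 0) (.seq (bump 1) (incr 5))).det params (item x))^[es.length] m0 := by
    rw [← hsize]; rfl
  -- Invariant: the slots below `k` are updated, the others are still as before, and no register but
  -- the loop index changes.
  have key := Function.iterate_induction_le
    ((Cmd.seq (bump 0) (.seq (bump 1) (incr 5))).det params (item x))
    (fun k m' => m'.read 5 = k ∧ (∀ a, a ≠ 5 → a < 10 → m'.read a = m.read a) ∧
      ∀ j e, es[j]? = some e → Stored m' j (if j < k then e.bump x else e))
    (k := es.length) (x := m0)
    ⟨by rw [r0, if_pos rfl], fun a ha _ => by rw [r0, if_neg ha], fun j e he => by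
      simpa using (h.stored j e he).congr fun a _ _ => by rw [r0, if_neg (by omega)]⟩
    fun k hk m' ⟨h1, h2, h3⟩ => by
      have hget : es[k]? = some es[k] := List.getElem?_eq_getElem hk
      have hsk := h3 k _ hget
      rw [if_neg (lt_irrefl k)] at hsk
      have hbd := hes es[k] (List.getElem_mem hk)
      obtain ⟨g1, g2, g3⟩ := det_bumpBody (params := params) (x := x) h1 hsk (by omega) hbd.1 hbd.2
        (by omega)
      refine ⟨g1, fun a ha ha' => (g3 a ha (by omega)).trans (h2 a ha ha'), fun j e he => ?_⟩
      rcases lt_trichotomy j k with hj | rfl | hj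
      · have := h3 j e he
        rw [if_pos hj] at this
        rw [if_pos (by omega)]
        exact this.congr fun a _ _ => g3 a (by omega) (by omega)
      · rw [if_pos (by omega)]
        rw [hget, Option.some.injEq] at he
        exact he ▸ g2
      · have := h3 j e he
        rw [if_neg (by omega)] at this
        rw [if_neg (by omega)]
        exact this.congr fun a _ _ => g3 a (by omega) (by omega)
  rw [← heq] at key
  obtain ⟨-, k2, k3⟩ := key
  refine ⟨⟨?_, ?_, ?_, ?_, ?_, fun j e he => ?_⟩, k2 7 (by omega) (by omega)⟩
  · rw [k2 0 (by omega) (by omega), h.size, List.length_map]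
  · rw [k2 1 (by omega) (by omega), h.threshold]
  · rw [k2 2 (by omega) (by omega), h.best]
  · rw [k2 3 (by omega) (by omega), h.bits]
  · rw [k2 4 (by omega) (by omega), h.range]
  · rw [List.getElem?_map, Option.map_eq_some_iff] at he
    obtain ⟨e', he', rfl⟩ := he
    have hj : j < es.length := (List.getElem?_eq_some_iff.1 he').1
    simpa [hj] using k3 j e' he'

theorem Holds.append {m : Memory w b} {q B M r : ℕ} {es : List (Entry n)} (h : Holds m q B M es)
    (hw : 15 + 5 * es.length ≤ w) (hb : es.length + 1 < 2 ^ b) (hn : n ≤ 2 ^ b)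
    (hr : m.read 7 = r) :
    Holds (Sketch.append.det params (item x) m) q B M (es ++ [Entry.new (x, r)]) := by
  have hrb : r < 2 ^ b := hr ▸ m.read_lt 7
  have hu : (x.1 : ℕ) < 2 ^ b := by omega
  have hv : (x.2 : ℕ) < 2 ^ b := by omega
  generalize hN : es.length = N at *
  have hsize := h.size
  rw [hN] at hsize
  let m1 := m.write (10 + 5 * N) x.1
  have r1 := m.read_write (a := 10 + 5 * N) (v := x.1) (by omega) hu
  let m2 := m1.write (11 + 5 * N) x.2
  have r2 := m1.read_write (a := 11 + 5 * N) (v := x.2) (by omega) hv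
  let m3 := m2.write (12 + 5 * N) 0
  have r3 := m2.read_write (a := 12 + 5 * N) (v := 0) (by omega) (by omega)
  let m4 := m3.write (13 + 5 * N) 0
  have r4 := m3.read_write (a := 13 + 5 * N) (v := 0) (by omega) (by omega)
  let m5 := m4.write (14 + 5 * N) r
  have r5 := m4.read_write (a := 14 + 5 * N) (v := r) (by omega) hrb
  let m6 := m5.write 0 (N + 1)
  have r6 := m5.read_write (a := 0) (v := N + 1) (by omega) hb
  have a1 : m1.read 0 = N := by rw [r1, if_neg (by omega), hsize]
  have a2 : m2.read 0 = N := by rw [r2, if_neg (by omega), a1]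
  have a3 : m3.read 0 = N := by rw [r3, if_neg (by omega), a2]
  have a4 : m4.read 0 = N := by rw [r4, if_neg (by omega), a3]
  have a5 : m5.read 0 = N := by rw [r5, if_neg (by omega), a4]
  have b4 : m4.read 7 = r := by
    rw [r4, if_neg (by omega), r3, if_neg (by omega), r2, if_neg (by omega), r1, if_neg (by omega),
      hr]
  have e1 : (Cmd.store (slot Sketch.size 0) (.item 0)).det params (item x) m = m1 := by
    simp only [Cmd.det, Expr.eval, hsize]; rfl
  have e2 : (Cmd.store (slot Sketch.size 1) (.item 1)).det params (item x) m1 = m2 := by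
    simp only [Cmd.det, Expr.eval, a1]; rfl
  have e3 : (Cmd.store (slot Sketch.size 2) (.lit 0)).det params (item x) m2 = m3 := by
    simp only [Cmd.det, Expr.eval, a2]; rfl
  have e4 : (Cmd.store (slot Sketch.size 3) (.lit 0)).det params (item x) m3 = m4 := by
    simp only [Cmd.det, Expr.eval, a3]; rfl
  have e5 : (Cmd.store (slot Sketch.size 4) Sketch.random).det params (item x) m4 = m5 := by
    simp only [Cmd.det, Expr.eval, a4, b4]; rfl
  have e6 : (incr 0).det params (item x) m5 = m6 := by
    simp only [Cmd.det, Expr.eval, a5]; rfl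
  have heq : Sketch.append.det params (item x) m = m6 := by
    rw [← e6, ← e5, ← e4, ← e3, ← e2, ← e1]; rfl
  have hread : ∀ a, m6.read a = if a = 0 then N + 1 else if a = 14 + 5 * N then r else
      if a = 13 + 5 * N then 0 else if a = 12 + 5 * N then 0 else if a = 11 + 5 * N then (x.2 : ℕ)
      else if a = 10 + 5 * N then (x.1 : ℕ) else m.read a := fun a => by
    rw [r6, r5, r4, r3, r2, r1]
  have hsame : ∀ a, a ≠ 0 → a < 10 + 5 * N → m6.read a = m.read a := fun a h1 h2 => by
    rw [hread, if_neg (by omega), if_neg (by omega), if_neg (by omega), if_neg (by omega),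
      if_neg (by omega), if_neg (by omega)]
  rw [heq]
  refine ⟨by rw [hread, if_pos rfl, List.length_append, hN]; rfl,
    (hsame _ (by omega) (by omega)).trans h.threshold,
    (hsame _ (by omega) (by omega)).trans h.best,
    (hsame _ (by omega) (by omega)).trans h.bits,
    (hsame _ (by omega) (by omega)).trans h.range, fun j e he => ?_⟩
  rcases lt_or_ge j N with hj | hj
  · rw [List.getElem?_append_left (by omega)] at he
    exact (h.stored j e he).congr fun a _ _ => hsame a (by omega) (by omega)
  · rw [List.getElem?_append_right (by omega), hN] at he
    have hjN : j = N := by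
      have := (List.getElem?_eq_some_iff.1 he).1
      simp at this
      omega
    subst hjN
    simp only [Nat.sub_self, List.getElem?_cons_zero, Option.some.injEq] at he
    subst he
    refine ⟨?_, ?_, ?_, ?_, ?_⟩ <;> rw [hread] <;> simp [Entry.new]

end Sketch

/-! ### Compaction, halving of the threshold, recording of the estimate -/

namespace Sketch

open Streaming

variable {n w b : ℕ} {params item : List ℕ}

/-- As `j ≤ i`, writing a field of slot `j` cannot destroy a later field of slot `i`, so the five
copies may be made in order even when the slots coincide. -/
theorem det_copyAll {m : Memory w b} {i j : ℕ} {e : Entry n} (hi : m.read 5 = i)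
    (hj : m.read 6 = j) (hji : j ≤ i) (he : Stored m i e) (hw : 15 + 5 * i ≤ w)
    (hjb : j + 1 < 2 ^ b) :
    (copyAll.det params item m).read 6 = j + 1 ∧ Stored (copyAll.det params item m) j e ∧
      ∀ a, a ≠ 6 → (a < 10 + 5 * j ∨ 15 + 5 * j ≤ a) →
        (copyAll.det params item m).read a = m.read a := by
  let m1 := m.write (10 + 5 * j) e.u
  have r1 := m.read_write (a := 10 + 5 * j) (v := e.u) (by omega) (he.u ▸ m.read_lt _)
  let m2 := m1.write (11 + 5 * j) e.v
  have r2 := m1.read_write (a := 11 + 5 * j) (v := e.v) (by omega) (he.v ▸ m.read_lt _)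
  let m3 := m2.write (12 + 5 * j) e.cu
  have r3 := m2.read_write (a := 12 + 5 * j) (v := e.cu) (by omega) (he.cu ▸ m.read_lt _)
  let m4 := m3.write (13 + 5 * j) e.cv
  have r4 := m3.read_write (a := 13 + 5 * j) (v := e.cv) (by omega) (he.cv ▸ m.read_lt _)
  let m5 := m4.write (14 + 5 * j) e.r
  have r5 := m4.read_write (a := 14 + 5 * j) (v := e.r) (by omega) (he.r ▸ m.read_lt _)
  let m6 := m5.write 6 (j + 1)
  have r6 := m5.read_write (a := 6) (v := j + 1) (by omega) hjb
  have hlow1 : ∀ a, a < 10 → m1.read a = m.read a := fun a ha => by rw [r1, if_neg (by omega)]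
  have hlow2 : ∀ a, a < 10 → m2.read a = m.read a := fun a ha => by
    rw [r2, if_neg (by omega), hlow1 a ha]
  have hlow3 : ∀ a, a < 10 → m3.read a = m.read a := fun a ha => by
    rw [r3, if_neg (by omega), hlow2 a ha]
  have hlow4 : ∀ a, a < 10 → m4.read a = m.read a := fun a ha => by
    rw [r4, if_neg (by omega), hlow3 a ha]
  have hlow5 : ∀ a, a < 10 → m5.read a = m.read a := fun a ha => by
    rw [r5, if_neg (by omega), hlow4 a ha]
  have e1 : (copy 0).det params item m = m1 := by
    simp only [copy, Cmd.det, Expr.eval, hi, hj, Nat.add_zero, he.u, m1]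
  have e2 : (copy 1).det params item m1 = m2 := by
    have : m1.read (11 + 5 * i) = e.v := by rw [r1, if_neg (by omega), he.v]
    simp only [copy, Cmd.det, Expr.eval, hlow1 5 (by omega), hlow1 6 (by omega), hi, hj,
      Nat.reduceAdd, this, m2]
  have e3 : (copy 2).det params item m2 = m3 := by
    have : m2.read (12 + 5 * i) = e.cu := by
      rw [r2, if_neg (by omega), r1, if_neg (by omega), he.cu]
    simp only [copy, Cmd.det, Expr.eval, hlow2 5 (by omega), hlow2 6 (by omega), hi, hj,
      Nat.reduceAdd, this, m3]
  have e4 : (copy 3).det params item m3 = m4 := by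
    have : m3.read (13 + 5 * i) = e.cv := by
      rw [r3, if_neg (by omega), r2, if_neg (by omega), r1, if_neg (by omega), he.cv]
    simp only [copy, Cmd.det, Expr.eval, hlow3 5 (by omega), hlow3 6 (by omega), hi, hj,
      Nat.reduceAdd, this, m4]
  have e5 : (copy 4).det params item m4 = m5 := by
    have : m4.read (14 + 5 * i) = e.r := by
      rw [r4, if_neg (by omega), r3, if_neg (by omega), r2, if_neg (by omega), r1,
        if_neg (by omega), he.r]
    simp only [copy, Cmd.det, Expr.eval, hlow4 5 (by omega), hlow4 6 (by omega), hi, hj,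
      Nat.reduceAdd, this, m5]
  have e6 : (incr 6).det params item m5 = m6 := by
    simp only [Cmd.det, Expr.eval, hlow5 6 (by omega), hj, m6]
  have heq : copyAll.det params item m = m6 := by
    rw [← e6, ← e5, ← e4, ← e3, ← e2, ← e1]; rfl
  have hread : ∀ a, m6.read a = if a = 6 then j + 1 else if a = 14 + 5 * j then e.r else
      if a = 13 + 5 * j then e.cv else if a = 12 + 5 * j then e.cu
      else if a = 11 + 5 * j then (e.v : ℕ) else if a = 10 + 5 * j then (e.u : ℕ)
      else m.read a := fun a => by rw [r6, r5, r4, r3, r2, r1]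
  rw [heq]
  refine ⟨by rw [hread, if_pos rfl], ⟨?_, ?_, ?_, ?_, ?_⟩, fun a ha ha' => ?_⟩
  · rw [hread, if_neg (by omega), if_neg (by omega), if_neg (by omega), if_neg (by omega),
      if_neg (by omega), if_pos rfl]
  · rw [hread, if_neg (by omega), if_neg (by omega), if_neg (by omega), if_neg (by omega),
      if_pos rfl]
  · rw [hread, if_neg (by omega), if_neg (by omega), if_neg (by omega), if_pos rfl]
  · rw [hread, if_neg (by omega), if_neg (by omega), if_pos rfl]
  · rw [hread, if_neg (by omega), if_pos rfl]
  · rw [hread, if_neg (by omega), if_neg (by omega), if_neg (by omega), if_neg (by omega),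
      if_neg (by omega), if_neg (by omega)]

theorem eval_keepTest {α : ℕ} (hα : params.getD 1 0 = α) {m : Memory w b} {i q : ℕ} {e : Entry n}
    (hi : m.read 5 = i) (hq : m.read 1 = q) (he : Stored m i e) :
    keepTest.eval params item m ≠ 0 ↔ e.keep α q = true := by
  have h1 := he.cu
  have h2 := he.cv
  have h3 := he.r
  simp only [keepTest, Expr.eval, hi, hq, hα, Nat.reduceAdd, h1, h2, h3, Entry.keep,
    decide_eq_true_eq, Nat.lt_succ_iff]
  split_ifs <;> simp_all

theorem Holds.prune {α : ℕ} (hα : params.getD 1 0 = α) {m : Memory w b} {q q' B M : ℕ}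
    {es : List (Entry n)} (h : Holds m q B M es) (hw : 10 + 5 * es.length ≤ w) (hw0 : 10 ≤ w)
    (hq : q = q') :
    Holds (Sketch.prune.det params item m) q B M (es.filter (Entry.keep α q')) := by
  subst hq
  have hb : es.length < 2 ^ b := h.size ▸ m.read_lt 0
  let m0 := m.write 5 0
  have r0 := m.read_write (a := 5) (v := 0) (by omega) (by omega)
  let m1 := m0.write 6 0
  have r1 := m0.read_write (a := 6) (v := 0) (by omega) (by omega)
  have hsize : Sketch.size.eval params item m1 % 2 ^ b = es.length := by
    simp only [Expr.eval, m1]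
    rw [r1, if_neg (by omega), r0, if_neg (by omega), h.size, Nat.mod_eq_of_lt hb]
  let body : Cmd := .seq (.ite keepTest copyAll .skip) (incr 5)
  have heq : Sketch.prune.det params item m =
      (set 0 dst).det params item ((body.det params item)^[es.length] m1) := by
    rw [← hsize]; rfl
  -- Invariant after `k` rounds: the first slots hold the filtered prefix of length `k`, register 6
  -- its length, and the slots from `k` on are untouched.
  have key := Function.iterate_induction_le (body.det params item)
    (fun k m' => m'.read 5 = k ∧ m'.read 6 = ((es.take k).filter (Entry.keep α q)).length ∧
      (∀ a, a ≠ 5 → a ≠ 6 → a < 10 → m'.read a = m.read a) ∧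
      (∀ j e, ((es.take k).filter (Entry.keep α q))[j]? = some e → Stored m' j e) ∧
      ∀ j e, k ≤ j → es[j]? = some e → Stored m' j e)
    (k := es.length) (x := m1)
    ⟨by rw [r1, if_neg (by omega), r0, if_pos rfl], by rw [r1, if_pos rfl]; rfl,
      fun a h1 h2 _ => by rw [r1, if_neg h2, r0, if_neg h1], fun j e he => by simp at he,
      fun j e _ he => (h.stored j e he).congr fun a _ _ => by
        rw [r1, if_neg (by omega), r0, if_neg (by omega)]⟩
    fun k hk m' ⟨h1, h2, h3, h4, h5⟩ => by
      have hget : es[k]? = some es[k] := List.getElem?_eq_getElem hk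
      have hsk := h5 k _ le_rfl hget
      have hq' : m'.read 1 = q := (h3 1 (by omega) (by omega) (by omega)).trans h.threshold
      have htest := eval_keepTest (item := item) hα h1 hq' hsk
      have htake : (es.take (k + 1)).filter (Entry.keep α q) =
          (es.take k).filter (Entry.keep α q) ++ [es[k]].filter (Entry.keep α q) := by
        rw [← List.filter_append, List.take_append_getElem hk]
      have hlen : ((es.take k).filter (Entry.keep α q)).length ≤ k :=
        (List.length_filter_le _ _).trans (by simp)
      rw [htake]
      generalize hF : (es.take k).filter (Entry.keep α q) = F at *
      by_cases hkeep : Entry.keep α q es[k] = true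
      · obtain ⟨g1, g2, g3⟩ := det_copyAll (params := params) (item := item) h1 h2 hlen hsk
          (by omega) (by omega)
        set m'' := copyAll.det params item m'
        have g5 : m''.read 5 = k := (g3 5 (by omega) (by omega)).trans h1
        have hbody : body.det params item m' = m''.write 5 (k + 1) := by
          simp only [body, Cmd.det]
          rw [if_pos (htest.2 hkeep)]
          change m''.write 5 (m''.read 5 + 1) = _
          rw [g5]
        have r2 := m''.read_write (a := 5) (v := k + 1) (by omega) (by omega)
        rw [hbody, List.filter_cons_of_pos hkeep, List.filter_nil]
        refine ⟨by rw [r2, if_pos rfl], by rw [r2, if_neg (by omega), g1]; simp,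
          fun a ha ha' ha'' => by rw [r2, if_neg ha, g3 a ha' (by omega), h3 a ha ha' ha''],
          fun j e he => ?_, fun j e hj he => ?_⟩
        · rcases lt_or_ge j F.length with hj | hj
          · rw [List.getElem?_append_left hj] at he
            exact (h4 j e he).congr fun a _ _ => by
              rw [r2, if_neg (by omega), g3 a (by omega) (by omega)]
          · rw [List.getElem?_append_right hj] at he
            have hjF : j = F.length := by
              have := (List.getElem?_eq_some_iff.1 he).1
              simp at this
              omega
            subst hjF
            simp only [Nat.sub_self, List.getElem?_cons_zero, Option.some.injEq] at he
            subst he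
            exact g2.congr fun a _ _ => by rw [r2, if_neg (by omega)]
        · exact (h5 j e (by omega) he).congr fun a _ _ => by
            rw [r2, if_neg (by omega), g3 a (by omega) (by omega)]
      · have hbody : body.det params item m' = m'.write 5 (k + 1) := by
          simp only [body, Cmd.det]
          rw [if_neg (mt htest.1 hkeep)]
          change m'.write 5 (m'.read 5 + 1) = _
          rw [h1]
        have r2 := m'.read_write (a := 5) (v := k + 1) (by omega) (by omega)
        rw [hbody, List.filter_cons_of_neg hkeep, List.filter_nil, List.append_nil]
        refine ⟨by rw [r2, if_pos rfl], by rw [r2, if_neg (by omega), h2],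
          fun a ha ha' ha'' => by rw [r2, if_neg ha, h3 a ha ha' ha''],
          fun j e he => (h4 j e he).congr fun a _ _ => by rw [r2, if_neg (by omega)],
          fun j e hj he => (h5 j e (by omega) he).congr fun a _ _ => by
            rw [r2, if_neg (by omega)]⟩
  rw [heq]
  generalize (body.det params item)^[es.length] m1 = m2 at key
  obtain ⟨-, k2, k3, k4, -⟩ := key
  rw [List.take_length] at k2 k4
  have hset : (set 0 dst).det params item m2 =
      m2.write 0 (es.filter (Entry.keep α q)).length := by
    simp only [Cmd.det, Expr.eval, k2]
  have r3 := m2.read_write (a := 0) (v := (es.filter (Entry.keep α q)).length) (by omega)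
    (k2 ▸ m2.read_lt 6)
  rw [hset]
  have hs : ∀ a, a ≠ 0 → a < 5 → (m2.write 0 (es.filter (Entry.keep α q)).length).read a =
      m.read a := fun a ha ha' => by
    rw [r3, if_neg ha, k3 a (by omega) (by omega) (by omega)]
  refine ⟨by rw [r3, if_pos rfl], (hs 1 (by omega) (by omega)).trans h.threshold,
    (hs 2 (by omega) (by omega)).trans h.best, (hs 3 (by omega) (by omega)).trans h.bits,
    (hs 4 (by omega) (by omega)).trans h.range,
    fun j e he => (k4 j e he).congr fun a _ _ => by rw [r3, if_neg (by omega)]⟩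

theorem Holds.shrink {α K k T : ℕ} (hα : params.getD 1 0 = α) (hk : params.getD 2 0 = k)
    {m : Memory w b} {q B M : ℕ} {h : List (Draw n)} (hm : Holds m q B M (live α h q))
    (hT : K * (k * k * M) = T) (hw : 15 + 5 * T ≤ w) (hlen : (live α h q).length ≤ T + 1)
    (hM : M + 1 < 2 ^ b) :
    Holds ((Sketch.shrink K).det params item m) ((halve α T h)^[M + 1] q) B M
      (live α h ((halve α T h)^[M + 1] q)) := by
  have hcount : (Expr.add Sketch.bits (.lit 1)).eval params item m % 2 ^ b = M + 1 := by
    simp only [Expr.eval]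
    rw [hm.bits, Nat.mod_eq_of_lt hM]
  have heq : (Sketch.shrink K).det params item m =
      (Cmd.det params item (.ite (.lt (capacity K) Sketch.size)
        (.seq (set 1 (.div Sketch.threshold (.lit 2))) Sketch.prune) .skip))^[M + 1] m := by
    rw [← hcount]; rfl
  rw [heq]
  -- The length bound `T + 1` is carried along because pruning needs all stored edges to lie in
  -- memory; the excess of one is the edge just appended.
  refine (Function.iterate_induction_le _ (fun j m' => Holds m' ((halve α T h)^[j] q) B M
    (live α h ((halve α T h)^[j] q)) ∧ (live α h ((halve α T h)^[j] q)).length ≤ T + 1)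
    ⟨hm, hlen⟩ fun j _ m' ⟨g1, g2⟩ => ?_).1
  rw [Function.iterate_succ_apply']
  generalize (halve α T h)^[j] q = q' at g1 g2
  have hcap : (capacity K).eval params item m' = T := by
    simp only [capacity, Expr.eval, hk, g1.bits, hT]
  simp only [Cmd.det, halve]
  rw [show (Expr.lt (capacity K) Sketch.size).eval params item m' =
    if T < (live α h q').length then 1 else 0 by
      rw [Expr.eval, hcap]
      simp only [Expr.eval, g1.size]]
  by_cases hlt : T < (live α h q').length
  · simp only [if_pos hlt, ne_eq, one_ne_zero, not_false_eq_true, if_true]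
    have hev : (Expr.div Sketch.threshold (.lit 2)).eval params item m' = q' / 2 := by
      simp only [Expr.eval, g1.threshold]
    have hqb : q' / 2 < 2 ^ b :=
      (Nat.div_le_self _ _).trans_lt (g1.threshold ▸ m'.read_lt 1)
    have r := m'.read_write (a := 1) (v := q' / 2) (by omega) hqb
    rw [hev, Expr.eval]
    have g3 : Holds (m'.write 1 (q' / 2)) (q' / 2) B M (live α h q') :=
      ⟨by rw [r, if_neg (by omega), g1.size], by rw [r, if_pos rfl],
        by rw [r, if_neg (by omega), g1.best], by rw [r, if_neg (by omega), g1.bits],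
        by rw [r, if_neg (by omega), g1.range], fun j e he => (g1.stored j e he).congr
          fun a _ _ => by rw [r, if_neg (by omega)]⟩
    have g4 := g3.prune (item := item) hα (by omega) (by omega) rfl
    rw [filter_live α h (Nat.div_le_self q' 2)] at g4
    refine ⟨g4, le_trans ?_ g2⟩
    rw [← filter_live α h (Nat.div_le_self q' 2)]
    exact List.length_filter_le _ _
  · simp only [if_neg hlt, ne_eq, not_true_eq_false, if_false]
    exact ⟨g1, g2⟩

theorem Holds.record {m : Memory w b} {q B M : ℕ} {es : List (Entry n)} (h : Holds m q B M es)
    (hw : 3 ≤ w) (hb : es.length * 2 ^ M < 2 ^ b) :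
    Holds (Sketch.record.det params item m) q (max B (es.length * 2 ^ M / q)) M es := by
  have hev : estimate.eval params item m = es.length * 2 ^ M / q := by
    simp only [estimate, Expr.eval, h.size, h.range, h.threshold]
  have r := m.read_write (a := 2) (v := es.length * 2 ^ M / q) (by omega)
    ((Nat.div_le_self _ _).trans_lt hb)
  simp only [Sketch.record, Cmd.det, Expr.eval, hev, h.best]
  by_cases hlt : B < es.length * 2 ^ M / q
  · simp only [if_pos hlt, ne_eq, one_ne_zero, not_false_eq_true, if_true, max_eq_right hlt.le]
    exact ⟨by rw [r, if_neg (by omega), h.size], by rw [r, if_neg (by omega), h.threshold],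
      by rw [r, if_pos rfl], by rw [r, if_neg (by omega), h.bits],
      by rw [r, if_neg (by omega), h.range], fun j e he => (h.stored j e he).congr
        fun a _ _ => by rw [r, if_neg (by omega)]⟩
  · simp only [if_neg hlt, ne_eq, not_true_eq_false, if_false, max_eq_left (not_lt.1 hlt)]
    exact h

/-- One update preserves the correspondence with the abstract process. The hypothesis `hlen` guards
against truncation both of the counters and of the product in the estimate. -/
theorem Holds.absorb {α K k T M : ℕ} (hα : params.getD 1 0 = α) (hk : params.getD 2 0 = k)
    (hT : K * (k * k * M) = T) (hw : 15 + 5 * T ≤ w) {m : Memory w b} {h : List (Draw n)}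
    {x : Draw n} (hm : Holds m (finalThreshold α T M h) (finalBest α T M h) M
      (live α h (finalThreshold α T M h))) (hr : m.read 7 = x.2) (hn : n ≤ 2 ^ b)
    (hM : M + 1 < 2 ^ b) (hlen : (2 * (h.length + 1) + 2) * 2 ^ M < 2 ^ b) :
    Holds ((Sketch.absorb K).det params (Sketch.item x.1) m) (finalThreshold α T M (x :: h))
      (finalBest α T M (x :: h)) M (live α (x :: h) (finalThreshold α T M (x :: h))) := by
  have hp := Nat.two_pow_pos M
  have hlen' : 2 * (h.length + 1) + 2 < 2 ^ b := lt_of_le_of_lt (Nat.le_mul_of_pos_right _ hp) hlen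
  have hl := length_live_le α h (finalThreshold α T M h)
  have hlT := length_live_finalThreshold_le α T M h
  obtain ⟨s1, s1'⟩ := hm.bumpAll (params := params) (x := x.1) (by omega) (by omega)
    fun e he => by
      have := counters_le h e (List.mem_filter.1 he).1
      omega
  have s2 := s1.append (params := params) (x := x.1) (by simpa using by omega) (by simpa using by omega) hn
    (s1'.trans hr)
  have s3 := s2.prune (item := Sketch.item x.1) hα (by simpa using by omega) (by omega) rfl
  rw [show (x.1, x.2) = x from rfl, live_cons] at s3
  have hl3 : (live α (x :: h) (finalThreshold α T M h)).length ≤ T + 1 := by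
    rw [← live_cons]
    refine (List.length_filter_le _ _).trans ?_
    simpa using hlT
  have s4 := s3.shrink (K := K) (item := Sketch.item x.1) hα hk hT hw hl3 hM
  have hl4 := length_live_le α (x :: h) (finalThreshold α T M (x :: h))
  have s5 := s4.record (params := params) (item := Sketch.item x.1) (by omega)
    (lt_of_le_of_lt (Nat.mul_le_mul_right _ (hl4.trans (by simp; omega))) hlen)
  exact s5

/-! ### Randomness -/

/-- Two independent uniform draws are one uniform draw from the product, here relabelled along a
bijection. -/
theorem uniform_bind_map {A B C X : Type*} [Fintype A] [Nonempty A] [Fintype B] [Nonempty B]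
    [Fintype C] [Nonempty C] (e : A × B ≃ C) (H : A → B → X) :
    ((PMF.uniformOfFintype A).bind fun a => (PMF.uniformOfFintype B).map (H a)) =
      (PMF.uniformOfFintype C).map fun c => H (e.symm c).1 (e.symm c).2 := by
  classical
  have h1 : PMF.uniformOfFintype C =
      (PMF.uniformOfFintype A).bind fun a => (PMF.uniformOfFintype B).map fun b => e (a, b) := by
    ext c
    obtain ⟨⟨a, b⟩, rfl⟩ := e.surjective c
    have hcard : Fintype.card C = Fintype.card A * Fintype.card B := by
      rw [← Fintype.card_prod, Fintype.card_congr e]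
    simp only [PMF.bind_apply, PMF.map_apply, PMF.uniformOfFintype_apply, tsum_fintype,
      EmbeddingLike.apply_eq_iff_eq, Prod.mk.injEq, hcard, Nat.cast_mul]
    rw [ENNReal.mul_inv (by simp) (by simp), Finset.sum_eq_single a, Finset.sum_eq_single b]
    · simp
    · intro b' _ hb
      simp [Ne.symm hb]
    · simp
    · intro a' _ ha
      simp [Ne.symm ha]
    · simp
  rw [h1, PMF.map_bind]
  congr 1
  funext a
  rw [PMF.map_comp]
  congr 1
  funext b
  simp

/-- After `j` tosses the memory is a function of a uniform `j`-bit number; even the leftover coin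
register is determined by it. -/
theorem exec_draw {m : Memory w b} {M : ℕ} (hM : m.read 3 = M) (hMb : M < 2 ^ b)
    (hb : 2 ^ M ≤ 2 ^ b) (hb0 : 2 ≤ 2 ^ b) (hw : 9 ≤ w) :
    ∃ F : Fin (2 ^ M) → Memory w b,
      draw.exec params item m = (PMF.uniformOfFintype (Fin (2 ^ M))).map F ∧
      ∀ r, (F r).read 7 = r ∧ ∀ a, a ≠ 7 → a ≠ 8 → (F r).read a = m.read a := by
  let m0 := m.write 7 0
  have r0 := m.read_write (a := 7) (v := 0) (by omega) (by omega)
  let body : Cmd := .seq (.flip (.lit 8)) (set 7 (.add (.mul (.lit 2) random) coin))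
  have hcount : bits.eval params item m0 % 2 ^ b = M := by
    simp only [Expr.eval, m0]
    rw [r0, if_neg (by omega), hM, Nat.mod_eq_of_lt hMb]
  have heq : draw.exec params item m =
      (fun μ : PMF (Memory w b) => μ.bind fun m' => body.exec params item m')^[M]
        (PMF.pure m0) := by
    simp only [draw, Cmd.exec, PMF.pure_bind]
    change (fun μ : PMF (Memory w b) => μ.bind fun m' => body.exec params item m')^[
      bits.eval params item m0 % 2 ^ b] (PMF.pure m0) = _
    rw [hcount]
  rw [heq]
  have key : ∀ j ≤ M, ∃ F : Fin (2 ^ j) → Memory w b,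
      (fun μ : PMF (Memory w b) => μ.bind fun m' => body.exec params item m')^[j]
        (PMF.pure m0) = (PMF.uniformOfFintype (Fin (2 ^ j))).map F ∧
      ∀ r, (F r).read 7 = r ∧ ∀ a, a ≠ 7 → a ≠ 8 → (F r).read a = m.read a := by
    intro j
    induction j with
    | zero =>
      refine fun _ => ⟨fun _ => m0, ?_, fun r => ⟨?_, fun a h1 _ => by rw [r0, if_neg h1]⟩⟩
      · exact (PMF.map_const _ _).symm
      · rw [r0, if_pos rfl]
        have := r.is_lt
        omega
    | succ j ih =>
      intro hj
      obtain ⟨F, hF, hF'⟩ := ih (by omega)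
      have hpow : 2 ^ (j + 1) ≤ 2 ^ M := Nat.pow_le_pow_right (by omega) hj
      let H : Fin (2 ^ j) → Bool → Memory w b := fun r c =>
        ((F r).write 8 c.toNat).write 7 (2 * r + c.toNat)
      have hH : ∀ r c a, (H r c).read a = if a = 7 then 2 * r + c.toNat else
          if a = 8 then c.toNat else (F r).read a := fun r c a => by
        have hc : c.toNat < 2 := by cases c <;> simp
        have := r.is_lt
        rw [pow_succ] at hpow
        rw [Memory.read_write _ (by omega) (by omega), Memory.read_write _ (by omega) (by omega)]
      have hbody : ∀ r, body.exec params item (F r) = (PMF.uniformOfFintype Bool).map (H r) := by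
        intro r
        simp only [body, Cmd.exec, Expr.eval, PMF.bind_map]
        rw [← PMF.bind_pure_comp]
        congr 1
        funext c
        have hc : c.toNat < 2 := by cases c <;> simp
        have h8 := (F r).read_write (a := 8) (v := c.toNat) (by omega) (by omega)
        simp only [Function.comp, H]
        rw [h8, h8, if_neg (by omega), if_pos rfl, (hF' r).1]
      -- The bijection `(r, c) ↦ 2 r + c`, appending one binary digit.
      let e : Fin (2 ^ j) × Bool ≃ Fin (2 ^ (j + 1)) :=
        ((Equiv.refl _).prodCongr finTwoEquiv.symm).trans finProdFinEquiv
      have he : ∀ r c, ((e (r, c) : Fin (2 ^ (j + 1))) : ℕ) = 2 * r + c.toNat := fun r c => by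
        have : ((e (r, c) : Fin (2 ^ (j + 1))) : ℕ) = (finTwoEquiv.symm c : ℕ) + 2 * r := rfl
        rw [this, add_comm]
        cases c <;> rfl
      refine ⟨fun s => H (e.symm s).1 (e.symm s).2, ?_, fun s => ⟨?_, fun a h1 h2 => ?_⟩⟩
      · rw [Function.iterate_succ_apply', hF, PMF.bind_map]
        simp only [Function.comp_def, hbody]
        exact uniform_bind_map e H
      · rw [hH, if_pos rfl, ← he]
        simp
      · rw [hH, if_neg h1, if_neg h2, (hF' _).2 a h1 h2]
  exact key M le_rfl

theorem isDet_absorb (K : ℕ) : (absorb K).IsDet := by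
  simp [absorb, bumpAll, bump, append, prune, copyAll, copy, shrink, record, Cmd.IsDet]

theorem exec_update {α K k T M : ℕ} (hα : params.getD 1 0 = α) (hk : params.getD 2 0 = k)
    (hT : K * (k * k * M) = T) (hw : 15 + 5 * T ≤ w) {m : Memory w b} {h : List (Draw n)}
    {x : Fin n × Fin n} (hm : Holds m (finalThreshold α T M h) (finalBest α T M h) M
      (live α h (finalThreshold α T M h))) (hn : n ≤ 2 ^ b)
    (hM : M + 1 < 2 ^ b) (hlen : (2 * (h.length + 1) + 2) * 2 ^ M < 2 ^ b) :
    ∃ F : Fin (2 ^ M) → Memory w b,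
      (program K).update.exec params (Sketch.item x) m =
        (PMF.uniformOfFintype (Fin (2 ^ M))).map F ∧
      ∀ r : Fin (2 ^ M), Holds (F r) (finalThreshold α T M ((x, r) :: h))
        (finalBest α T M ((x, r) :: h)) M
        (live α ((x, r) :: h) (finalThreshold α T M ((x, r) :: h))) := by
  have hMb : 2 ^ M ≤ 2 ^ b := (Nat.le_mul_of_pos_left _ (by omega)).trans hlen.le
  obtain ⟨F, hF, hF'⟩ := exec_draw (params := params) (item := Sketch.item x) hm.bits (by omega)
    hMb (by omega) (by omega)
  refine ⟨fun r => (absorb K).det params (Sketch.item x) (F r), ?_, fun r => ?_⟩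
  · simp only [program, Cmd.exec]
    rw [hF, PMF.bind_map, ← PMF.bind_pure_comp]
    congr 1
    funext r
    simp only [Function.comp]
    exact Cmd.exec_of_isDet _ _ (isDet_absorb K) _
  · obtain ⟨h7, hs⟩ := hF' r
    have hm' : Holds (F r) (finalThreshold α T M h) (finalBest α T M h) M
        (live α h (finalThreshold α T M h)) :=
      ⟨(hs 0 (by omega) (by omega)).trans hm.size, (hs 1 (by omega) (by omega)).trans hm.threshold,
        (hs 2 (by omega) (by omega)).trans hm.best, (hs 3 (by omega) (by omega)).trans hm.bits,
        (hs 4 (by omega) (by omega)).trans hm.range,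
        fun j e he => (hm.stored j e he).congr fun a _ _ => hs a (by omega) (by omega)⟩
    exact Holds.absorb (x := (x, (r : ℕ))) hα hk hT hw hm' h7 hn hM hlen

end Sketch

/-! ### Setup and the run on a whole stream -/

namespace Sketch

open Streaming

variable {n w b : ℕ} {params : List ℕ}

theorem exec_setup (hn : params.getD 0 0 = n) (hn1 : 1 ≤ n) (hw : 9 ≤ w)
    (hb : 2 * n ^ 2 < 2 ^ b) :
    ∃ (M : ℕ) (m : Memory w b), n ^ 2 ≤ 2 ^ M ∧ 2 ^ M ≤ 2 * n ^ 2 ∧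
      setup.exec params [] (fun _ => ⟨0, Nat.two_pow_pos b⟩) = PMF.pure m ∧
      Holds (n := n) m (2 ^ M) 0 M [] := by
  set z : Memory w b := fun _ => ⟨0, Nat.two_pow_pos b⟩
  have hz : ∀ a, z.read a = 0 := fun a => by
    unfold Memory.read
    split_ifs <;> rfl
  have hnn : n ≤ n ^ 2 := Nat.le_self_pow (by omega) n
  let m0 := z.write 4 1
  have r0 := z.read_write (a := 4) (v := 1) (by omega) (by omega)
  let body : Cmd := .ite (.lt range (.mul (.param 0) (.param 0)))
      (.seq (set 4 (.mul (.lit 2) range)) (incr 3)) .skip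
  have hcount : (Expr.mul (.lit 2) (.param 0)).eval params [] m0 % 2 ^ b = 2 * n := by
    simp only [Expr.eval, hn]
    exact Nat.mod_eq_of_lt (by omega)
  have heq : setup.det params [] z =
      (set 1 range).det params [] ((body.det params [])^[2 * n] m0) := by
    rw [← hcount]; rfl
  -- As long as the range is below `n²`, every round has doubled it, so `M` equals the number of
  -- rounds.
  have key := Function.iterate_induction_le (body.det params [])
    (fun j m' => m'.read 0 = 0 ∧ m'.read 2 = 0 ∧ ∃ M, m'.read 3 = M ∧ m'.read 4 = 2 ^ M ∧
      2 ^ M ≤ 2 * n ^ 2 ∧ (n ^ 2 ≤ 2 ^ M ∨ M = j)) (k := 2 * n) (x := m0)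
    ⟨by rw [r0, if_neg (by omega), hz], by rw [r0, if_neg (by omega), hz], 0,
      by rw [r0, if_neg (by omega), hz], by rw [r0, if_pos rfl]; rfl, by simp; omega, Or.inr rfl⟩
    fun j hj m' ⟨h0, h2, M, h3, h4, h5, h6⟩ => by
      have hsq : n * n = n ^ 2 := by ring
      simp only [body, Cmd.det, Expr.eval, hn, h4, hsq]
      by_cases hlt : 2 ^ M < n ^ 2
      · simp only [if_pos hlt, ne_eq, one_ne_zero, not_false_eq_true, if_true]
        have hM : M < 2 ^ M := Nat.lt_two_pow_self
        have r1 := m'.read_write (a := 4) (v := 2 * 2 ^ M) (by omega) (by omega)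
        have r2 := (m'.write 4 (2 * 2 ^ M)).read_write (a := 3) (v := M + 1) (by omega) (by omega)
        rw [show (m'.write 4 (2 * 2 ^ M)).read 3 = M by rw [r1, if_neg (by omega), h3]]
        refine ⟨by rw [r2, if_neg (by omega), r1, if_neg (by omega), h0],
          by rw [r2, if_neg (by omega), r1, if_neg (by omega), h2], M + 1,
          by rw [r2, if_pos rfl], by rw [r2, if_neg (by omega), r1, if_pos rfl, pow_succ]; omega,
          by rw [pow_succ]; omega, Or.inr ?_⟩
        rw [h6.resolve_left (by omega)]
      · simp only [if_neg hlt, ne_eq, not_true_eq_false, if_false]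
        exact ⟨h0, h2, M, h3, h4, h5, Or.inl (by omega)⟩
  generalize (body.det params [])^[2 * n] m0 = m1 at key heq
  obtain ⟨h0, h2, M, h3, h4, h5, h6⟩ := key
  have hMb : 2 ^ M < 2 ^ b := by omega
  have r := m1.read_write (a := 1) (v := 2 ^ M) (by omega) hMb
  refine ⟨M, m1.write 1 (2 ^ M), ?_, h5, ?_, ⟨?_, ?_, ?_, ?_, ?_, ?_⟩⟩
  · rcases h6 with h6 | rfl
    · exact h6
    -- If doubling never stopped, then `2 ^ M = (2 ^ n) ^ 2`, which exceeds `n ^ 2`.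
    · rw [mul_comm, pow_mul]
      exact Nat.pow_le_pow_left Nat.lt_two_pow_self.le 2
  · rw [Cmd.exec_of_isDet _ _ (by simp [setup, Cmd.IsDet]), heq]
    simp only [Cmd.det, Expr.eval, h4]
  · rw [r, if_neg (by omega), h0]; rfl
  · rw [r, if_pos rfl]
  · rw [r, if_neg (by omega), h2]
  · rw [r, if_neg (by omega), h3]
  · rw [r, if_neg (by omega), h4]
  · simp

/-- The history of a stream (newest item first) with random numbers `U`. -/
def hist {P : ℕ} (τ : List (Fin n × Fin n)) (U : Fin τ.length → Fin P) : List (Draw n) :=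
  List.ofFn fun i => (τ[i], (U i : ℕ))

theorem hist_cons {P : ℕ} (e : Fin n × Fin n) (τ : List (Fin n × Fin n))
    (U : Fin (e :: τ).length → Fin P) :
    hist (e :: τ) U = (e, (U 0 : ℕ)) :: hist τ (fun i => U i.succ) := List.ofFn_succ

theorem length_hist {P : ℕ} (τ : List (Fin n × Fin n)) (U : Fin τ.length → Fin P) :
    (hist τ U).length = τ.length := List.length_ofFn

/-- All randomness is collected into one uniform vector `U`, and the memory is a deterministic
function of it. The list runs from newest to oldest, so each new item adds a coordinate at the
front. -/
theorem exec_stream {α K k T M : ℕ} (hα : params.getD 1 0 = α) (hk : params.getD 2 0 = k)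
    (hT : K * (k * k * M) = T) (hw : 15 + 5 * T ≤ w) (hn : n ≤ 2 ^ b) (hM : M + 1 < 2 ^ b)
    {m : Memory w b} (hm : Holds (n := n) m (2 ^ M) 0 M []) (τ : List (Fin n × Fin n))
    (hlen : (2 * (τ.length + 1) + 2) * 2 ^ M < 2 ^ b) :
    ∃ F : (Fin τ.length → Fin (2 ^ M)) → Memory w b,
      (τ.reverse.map Sketch.item).foldl
        (fun (μ : PMF (Memory w b)) item =>
          μ.bind fun m => (program K).update.exec params item m) (PMF.pure m) =
        (PMF.uniformOfFintype (Fin τ.length → Fin (2 ^ M))).map F ∧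
      ∀ U, Holds (F U) (finalThreshold α T M (hist τ U)) (finalBest α T M (hist τ U)) M
        (live α (hist τ U) (finalThreshold α T M (hist τ U))) := by
  induction τ with
  | nil =>
    exact ⟨fun _ => m, (PMF.map_const _ _).symm, fun U => hm⟩
  | cons e τ ih =>
    obtain ⟨F, hF, hF'⟩ := ih (lt_of_le_of_lt (Nat.mul_le_mul_right _ (by simp)) hlen)
    have hstep := fun U => exec_update (x := e) hα hk hT hw (hF' U) hn hM
      (lt_of_le_of_lt (Nat.mul_le_mul_right _ (by rw [length_hist]; simp)) hlen)
    choose G hG hG' using hstep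
    let eqv := (Equiv.prodComm _ _).trans
      (Fin.consEquiv fun _ : Fin (τ.length + 1) => Fin (2 ^ M))
    refine ⟨fun V => G (eqv.symm V).1 (eqv.symm V).2, ?_, fun V => ?_⟩
    · rw [List.reverse_cons, List.map_append, List.foldl_append, hF]
      simp only [List.map_cons, List.map_nil, List.foldl_cons, List.foldl_nil]
      rw [PMF.bind_map]
      simp only [Function.comp_def, hG]
      exact uniform_bind_map eqv G
    · rw [hist_cons]
      exact hG' _ _

theorem run_program {α K k : ℕ} (hw9 : 9 ≤ w) (hn2 : 1 ≤ n) (σ : List (Fin n × Fin n))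
    (hw : ∀ M, 2 ^ M ≤ 2 * n ^ 2 → 15 + 5 * (K * (k * k * M)) ≤ w)
    (hb : (2 * (σ.length + 1) + 2) * (2 * n ^ 2) < 2 ^ b) :
    ∃ M, n ^ 2 ≤ 2 ^ M ∧ 2 ^ M ≤ 2 * n ^ 2 ∧
      (program K).run w b [n, α, k] (σ.map Sketch.item) =
        (PMF.uniformOfFintype (Fin σ.reverse.length → Fin (2 ^ M))).map fun U =>
          finalBest α (K * (k * k * M)) M (hist σ.reverse U) * (4 * k + 1) / (4 * k) := by
  have hb2 : 2 * n ^ 2 < 2 ^ b := lt_of_le_of_lt (Nat.le_mul_of_pos_left _ (by omega)) hb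
  have hnn : n ≤ n ^ 2 := Nat.le_self_pow (by omega) n
  obtain ⟨M, m, h1, h2, h3, h4⟩ := exec_setup (w := w) (n := n) (params := [n, α, k]) rfl hn2 hw9 hb2
  have hlen : (2 * (σ.reverse.length + 1) + 2) * 2 ^ M < 2 ^ b := by
    rw [List.length_reverse]
    exact lt_of_le_of_lt (Nat.mul_le_mul_left _ h2) hb
  have hM : M + 1 < 2 ^ b := by
    have : M < 2 ^ M := Nat.lt_two_pow_self
    have : 2 * 2 ^ M ≤ (2 * (σ.reverse.length + 1) + 2) * 2 ^ M :=
      Nat.mul_le_mul_right _ (by omega)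
    omega
  obtain ⟨F, hF, hF'⟩ := exec_stream (params := [n, α, k]) (α := α) (k := k) (K := K) rfl rfl
    rfl (hw M h2) (by omega)
    hM h4 σ.reverse hlen
  refine ⟨M, h1, h2, ?_⟩
  rw [List.reverse_reverse] at hF
  rw [Program.run]
  change PMF.map _ (List.foldl _ (setup.exec _ _ _) _) = _
  rw [h3, hF, PMF.map_comp]
  congr 1
  funext U
  simp only [Function.comp, program, Expr.eval, (hF' U).best]
  rfl

/-! ### The stored edges as a random sample -/

/-- The recursively updated counters agree with `EdgeList.later`: a new edge shifts the older
indices by one and adds its `hits` to their counters. -/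
theorem countP_track {P : ℕ} (τ : List (Fin n × Fin n)) (U : Fin τ.length → Fin P)
    (p : Entry n → Bool) :
    (track (hist τ U)).countP p = #(univ.filter fun i : Fin τ.length =>
      p ⟨τ[i].1, τ[i].2, EdgeList.later τ i τ[i].1, EdgeList.later τ i τ[i].2, U i⟩ = true) := by
  induction τ generalizing p with
  | nil => simp [hist, track]
  | cons e τ ih =>
    have hs : ∀ (i : ℕ) (y : Fin n), EdgeList.later (e :: τ) (i + 1) y =
        EdgeList.later τ i y + EdgeList.hits y e := fun i y => by
      rw [EdgeList.later]
      exact (Fin.sum_univ_succ _).trans (by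
        rw [add_comm, EdgeList.later]
        simp)
    have h0 : ∀ y : Fin n, EdgeList.later (e :: τ) 0 y = 0 := fun y => by simp [EdgeList.later]
    rw [hist_cons, track, List.countP_append, List.countP_map, ih, List.countP_singleton, add_comm]
    refine Eq.trans ?_ (Fin.card_filter_univ_succ _).symm
    simp only [Function.comp_def, Entry.bump, Entry.new, Fin.val_succ, hs]
    simp only [Fin.val_zero, h0]
    by_cases hp : p ⟨e.1, e.2, 0, 0, U 0⟩ = true
    · simp [hp, add_comm]
    · simp [hp]
      rfl

theorem length_live_hist {P : ℕ} (α : ℕ) (τ : List (Fin n × Fin n)) (U : Fin τ.length → Fin P)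
    (q : ℕ) : (live α (hist τ U) q).length =
      Sampling.sampleCount (EdgeList.good α τ) q U := by
  rw [live, ← List.countP_eq_length_filter, countP_track, Sampling.sampleCount, EdgeList.good,
    filter_filter]
  simp only [Entry.keep, decide_eq_true_eq, and_assoc]

/-- The samples at all earlier times are read off the same vector `U`, through index sets not
depending on `U`. This allows a union bound over time on one probability space. -/
theorem exists_sample (α : ℕ) (τ : List (Fin n × Fin n)) (s : ℕ) :
    ∃ A : Finset (Fin τ.length), #A = #(EdgeList.good α (τ.drop s)) ∧
      ∀ (P : ℕ) (U : Fin τ.length → Fin P) (q : ℕ),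
        (live α ((hist τ U).drop s) q).length = Sampling.sampleCount A q U := by
  induction s generalizing τ with
  | zero => exact ⟨_, rfl, fun P U q => length_live_hist α τ U q⟩
  | succ s ih =>
    cases τ with
    | nil => exact ⟨∅, by
        rw [List.drop_nil]
        exact (card_eq_zero.2 (eq_empty_of_isEmpty (α := Fin 0) _)).symm, fun P U q => by
        simp [hist, live, track, Sampling.sampleCount]⟩
    | cons e τ =>
      obtain ⟨A, hA, hA'⟩ := ih τ
      refine ⟨A.map (Fin.succEmb _), by rw [card_map, hA, List.drop_succ_cons], fun P U q => ?_⟩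
      rw [hist_cons, List.drop_succ_cons, hA', Sampling.sampleCount, Sampling.sampleCount,
        filter_map, card_map]
      rfl

end Sketch

namespace Sketch

open Streaming

/-! ### Analysis of the estimate -/

variable {n : ℕ}

theorem live_mul_div {M i : ℕ} (hi : i ≤ M) (N : ℕ) : N * 2 ^ M / 2 ^ (M - i) = N * 2 ^ i := by
  rw [show 2 ^ M = 2 ^ i * 2 ^ (M - i) by rw [← pow_add]; congr 1; omega, ← mul_assoc]
  exact Nat.mul_div_cancel _ (Nat.two_pow_pos _)

/-- If at all times the samples at the levels up to `i₀` are accurate, and the sample at level `i₀`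
fits into the memory, then the algorithm stops at one of these levels and is accurate. -/
theorem finalBest_accurate {α T M i₀ : ℕ} (hi₀ : i₀ ≤ M) {c : List (Draw n) → ℝ} {err E : ℝ}
    (h : List (Draw n)) (herr : 0 ≤ E + err)
    (hE : ∀ h', h' <:+ h → h' ≠ [] → c h' ≤ E)
    (hfit : ∀ h', h' <:+ h → h' ≠ [] → (live α h' (2 ^ (M - i₀))).length ≤ T)
    (hacc : ∀ h', h' <:+ h → h' ≠ [] → ∀ i ≤ i₀,
      |((live α h' (2 ^ (M - i))).length : ℝ) * 2 ^ i - c h'| ≤ err) :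
    (∃ i ≤ i₀, finalThreshold α T M h = 2 ^ (M - i)) ∧ (finalBest α T M h : ℝ) ≤ E + err ∧
      ∀ h', h' <:+ h → h' ≠ [] → c h' - err ≤ finalBest α T M h := by
  induction h with
  | nil =>
    refine ⟨⟨0, Nat.zero_le _, by simp [finalThreshold]⟩, by simpa [finalBest] using herr, ?_⟩
    intro h' hh' hne
    exact (hne (List.suffix_nil.1 hh')).elim
  | cons x h ih =>
    obtain ⟨⟨i, hi, hq⟩, hup, hlow⟩ := ih
      (fun h' hh' => hE h' (hh'.trans (List.suffix_cons x h)))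
      (fun h' hh' => hfit h' (hh'.trans (List.suffix_cons x h)))
      (fun h' hh' => hacc h' (hh'.trans (List.suffix_cons x h)))
    have hthr : ∃ i ≤ i₀, finalThreshold α T M (x :: h) = 2 ^ (M - i) := by
      refine Function.iterate_induction_le (halve α T (x :: h))
        (fun _ q => ∃ i ≤ i₀, q = 2 ^ (M - i)) ⟨i, hi, hq⟩ ?_
      rintro _ _ _ ⟨i, hi, rfl⟩
      unfold halve
      split_ifs with hlt
      -- The sample at level `i₀` fits, so an overflow can only happen at a smaller level and one
      -- halving stays within `i₀`.
      · have hne : i ≠ i₀ := by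
          rintro rfl
          exact (hfit _ List.suffix_rfl (by simp)).not_gt hlt
        refine ⟨i + 1, by omega, ?_⟩
        rw [show M - i = M - (i + 1) + 1 by omega, pow_succ, Nat.mul_div_cancel _ (by omega)]
      · exact ⟨i, hi, rfl⟩
    obtain ⟨i, hi, hq⟩ := hthr
    have hbest : finalBest α T M (x :: h) =
        max (finalBest α T M h) ((live α (x :: h) (2 ^ (M - i))).length * 2 ^ i) := by
      rw [finalBest]
      simp only [hq, live_mul_div (hi.trans hi₀)]
    have ha := abs_le.1 (hacc _ List.suffix_rfl (by simp) i hi)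
    have hc := hE _ List.suffix_rfl (by simp)
    refine ⟨⟨i, hi, hq⟩, ?_, fun h' hh' hne => ?_⟩
    · rw [hbest]
      push_cast
      exact max_le hup (by linarith)
    · rw [hbest]
      push_cast
      rcases List.suffix_cons_iff.1 hh' with rfl | hh'
      · exact le_max_of_le_right (by linarith)
      · exact le_max_of_le_left (hlow h' hh' hne)

/-- The largest number of good edges at any time. -/
def peak (α : ℕ) (τ : List (Fin n × Fin n)) : ℕ :=
  (Finset.range τ.length).sup fun s => #(EdgeList.good α (τ.drop s))

theorem good_le_peak (α : ℕ) (τ : List (Fin n × Fin n)) {s : ℕ} (hs : s < τ.length) :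
    #(EdgeList.good α (τ.drop s)) ≤ peak α τ :=
  le_sup (f := fun s => #(EdgeList.good α (τ.drop s))) (mem_range.2 hs)

theorem peak_le (α : ℕ) (τ : List (Fin n × Fin n)) : peak α τ ≤ τ.length := by
  refine Finset.sup_le fun s _ => (card_le_univ _).trans ?_
  simp

theorem map_fst_hist {P : ℕ} (τ : List (Fin n × Fin n)) (U : Fin τ.length → Fin P) :
    (hist τ U).map Prod.fst = τ := by
  rw [hist, List.map_ofFn]
  exact List.ofFn_getElem

open Sampling

/-- All but few choices of the random numbers lead to an accurate estimate of the peak. -/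
theorem exists_bad (α k K M c : ℕ) (hk : 1 ≤ k) (hM : 1 ≤ M) (hK : K = 1024 * (c + 5))
    (τ : List (Fin n × Fin n)) (hτ : τ.length ≤ 2 ^ M) :
    ∃ bad : Finset (Fin τ.length → Fin (2 ^ M)),
      (#bad : ℝ) ≤ τ.length * M * (2 * (((2 ^ M : ℕ) : ℝ) ^ τ.length *
        Real.exp (-((c + 5 : ℕ) * M : ℝ)))) ∧
      ∀ U ∉ bad, |(finalBest α (K * (k * k * M)) M (hist τ U) : ℝ) - peak α τ| ≤
        1 / (8 * k) * peak α τ := by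
  classical
  set T := K * (k * k * M) with hT
  set E : ℝ := ((peak α τ : ℕ) : ℝ) with hE
  set δ : ℝ := 1 / (8 * k) with hδ
  have hk' : (1 : ℝ) ≤ k := by exact_mod_cast hk
  have hδ0 : 0 < δ := by positivity
  have hδ1 : δ ≤ 1 := by
    rw [hδ, div_le_one (by positivity)]
    linarith
  have hE0 : 0 ≤ E := Nat.cast_nonneg _
  have hT2 : 2 ≤ T := by
    have : 0 < k * k * M := by positivity
    rw [hT, hK]
    nlinarith
  have hEM : E ≤ 2 ^ M := by
    rw [hE]
    exact_mod_cast (peak_le α τ).trans hτ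
  -- The critical level `i₀` is the first one at which even an upward deviation by `δ` fits into the
  -- capacity `T`; level `M` qualifies since `E ≤ 2 ^ M`.
  have hex : ∃ i, (1 / 2 : ℝ) ^ i * E * (1 + δ) ≤ T := ⟨M, by
    have h1 : (1 / 2 : ℝ) ^ M * E ≤ 1 := by
      calc (1 / 2 : ℝ) ^ M * E ≤ (1 / 2 : ℝ) ^ M * 2 ^ M := by gcongr
        _ = 1 := by rw [← mul_pow]; norm_num
    have h2 : (2 : ℝ) ≤ T := by exact_mod_cast hT2
    nlinarith⟩
  set i₀ := Nat.find hex with hi₀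
  have hfind := Nat.find_spec hex
  rw [← hi₀] at hfind
  have hi₀M : i₀ ≤ M := Nat.find_min' hex (by
    have h1 : (1 / 2 : ℝ) ^ M * E ≤ 1 := by
      calc (1 / 2 : ℝ) ^ M * E ≤ (1 / 2 : ℝ) ^ M * 2 ^ M := by gcongr
        _ = 1 := by rw [← mul_pow]; norm_num
    have h2 : (2 : ℝ) ≤ T := by exact_mod_cast hT2
    nlinarith)
  -- Level `i₀ - 1` does not fit, so `T < 2 (1/2)^(i₀ - 1) E = 4 (1/2)^i₀ E`: up to `i₀` the scale
  -- is large enough for concentration.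
  have hbig : ∀ i, 1 ≤ i → i ≤ i₀ → (T : ℝ) / 4 ≤ (1 / 2 : ℝ) ^ i * E := fun i hi1 hi => by
    have h1 := Nat.find_min hex (m := i₀ - 1) (by omega)
    push Not at h1
    have h2 : (1 / 2 : ℝ) ^ i₀ * E ≤ (1 / 2 : ℝ) ^ i * E :=
      mul_le_mul_of_nonneg_right (pow_le_pow_of_le_one (by norm_num) (by norm_num) hi) hE0
    have h3 : (1 / 2 : ℝ) ^ i₀ = (1 / 2 : ℝ) ^ (i₀ - 1) * (1 / 2) := by
      rw [← pow_succ]; congr 1; omega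
    have h4 : 0 ≤ (1 / 2 : ℝ) ^ (i₀ - 1) * E := by positivity
    rw [h3] at h2
    nlinarith
  choose A hA hA' using exists_sample α τ
  have hratio : ∀ i ≤ M, ((2 ^ (M - i) : ℕ) : ℝ) / ((2 ^ M : ℕ) : ℝ) = (1 / 2 : ℝ) ^ i :=
    fun i hi => by
      rw [show M = M - i + i by omega]
      push_cast
      rw [pow_add, Nat.add_sub_cancel]
      field_simp
      rw [← mul_pow]
      norm_num
  let tail : ℕ → ℕ → Finset (Fin τ.length → Fin (2 ^ M)) := fun s i => univ.filter fun U =>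
    δ * (((2 ^ (M - i) : ℕ) : ℝ) / ((2 ^ M : ℕ) : ℝ) * E) <
      |(sampleCount (A s) (2 ^ (M - i)) U : ℝ) - ((2 ^ (M - i) : ℕ) : ℝ) / ((2 ^ M : ℕ) : ℝ) * #(A s)|
  have hAE : ∀ s < τ.length, (#(A s) : ℝ) ≤ E := fun s hs => by
    rw [hA, hE]
    exact_mod_cast good_le_peak α τ hs
  have htail : ∀ s < τ.length, ∀ i, 1 ≤ i → i ≤ i₀ → (#(tail s i) : ℝ) ≤
      2 * (((2 ^ M : ℕ) : ℝ) ^ τ.length * Real.exp (-((c + 5 : ℕ) * M : ℝ))) := by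
    intro s hs i hi1 hi
    refine (card_tail_le (A s) (Nat.pow_le_pow_right (by omega) (Nat.sub_le M i))
      (Nat.two_pow_pos M) (hAE s hs) hδ1 hδ0).trans ?_
    rw [hratio i (hi.trans hi₀M)]
    gcongr
    have h1 := hbig i hi1 hi
    -- Here `δ = 1/(8k)` and `T = K k² M`, so the exponent is `K M / 1024`; this fixes `K = 1024 (c
    -- + 5)`.
    have h2 : (T : ℝ) / 4 * δ ^ 2 / 4 = (c + 5 : ℕ) * M := by
      rw [hT, hδ, hK]
      push_cast
      field_simp
      norm_num
    rw [← h2]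
    gcongr
  refine ⟨(Finset.range τ.length).biUnion fun s => (Icc 1 i₀).biUnion (tail s), ?_, fun U hU => ?_⟩
  · set y := 2 * (((2 ^ M : ℕ) : ℝ) ^ τ.length * Real.exp (-((c + 5 : ℕ) * M : ℝ)))
    have hy : 0 ≤ y := by positivity
    have h1 : ∀ s ∈ Finset.range τ.length, (#((Icc 1 i₀).biUnion (tail s)) : ℝ) ≤ M * y := by
      intro s hs
      calc (#((Icc 1 i₀).biUnion (tail s)) : ℝ) ≤ ∑ i ∈ Icc 1 i₀, (#(tail s i) : ℝ) := by
            exact_mod_cast card_biUnion_le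
        _ ≤ ∑ i ∈ Icc 1 i₀, y := sum_le_sum fun i hi =>
            htail s (mem_range.1 hs) i (mem_Icc.1 hi).1 (mem_Icc.1 hi).2
        _ = i₀ * y := by simp
        _ ≤ M * y := by gcongr
    calc _ ≤ ∑ s ∈ Finset.range τ.length, (#((Icc 1 i₀).biUnion (tail s)) : ℝ) := by
          exact_mod_cast card_biUnion_le
      _ ≤ ∑ s ∈ Finset.range τ.length, M * y := sum_le_sum h1
      _ = τ.length * M * y := by simp [mul_assoc]
  · have hgood : ∀ s < τ.length, ∀ i ≤ i₀,
        |(sampleCount (A s) (2 ^ (M - i)) U : ℝ) - (1 / 2 : ℝ) ^ i * #(A s)| ≤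
          δ * ((1 / 2 : ℝ) ^ i * E) := by
      intro s hs i hi
      -- At level 0 every edge is sampled and the count is exact, so no bad event is needed.
      rcases Nat.eq_zero_or_pos i with rfl | hi1
      · have : sampleCount (A s) (2 ^ (M - 0)) U = #(A s) := by
          rw [sampleCount, Nat.sub_zero, filter_true_of_mem fun j _ => (U j).is_lt]
        rw [this]
        simp only [pow_zero, one_mul, sub_self, abs_zero]
        positivity
      · by_contra hcon
        refine hU (mem_biUnion.2 ⟨s, mem_range.2 hs, mem_biUnion.2 ⟨i, mem_Icc.2 ⟨hi1, hi⟩,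
          mem_filter.2 ⟨mem_univ _, ?_⟩⟩⟩)
        rw [hratio i (hi.trans hi₀M)]
        exact not_le.1 hcon
    have hsuf : ∀ h', h' <:+ hist τ U → h' ≠ [] → ∃ s < τ.length, h' = (hist τ U).drop s := by
      intro h' hh' hne
      refine ⟨(hist τ U).length - h'.length, ?_, List.suffix_iff_eq_drop.1 hh'⟩
      have := hh'.length_le
      have := List.length_pos_iff.2 hne
      rw [length_hist] at *
      omega
    let cnt : List (Draw n) → ℝ := fun h' => #(EdgeList.good α (h'.map Prod.fst))
    have hcnt : ∀ s, cnt ((hist τ U).drop s) = #(A s) := fun s => by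
      simp only [cnt]
      rw [List.map_drop, map_fst_hist, hA]
    obtain ⟨-, hup, hlow⟩ := finalBest_accurate (α := α) (T := T) hi₀M (c := cnt) (err := δ * E)
      (E := E) (hist τ U) (by positivity)
      (fun h' hh' hne => by
        obtain ⟨s, hs, rfl⟩ := hsuf h' hh' hne
        rw [hcnt]
        exact hAE s hs)
      (fun h' hh' hne => by
        obtain ⟨s, hs, rfl⟩ := hsuf h' hh' hne
        rw [hA']
        have h1 := (abs_le.1 (hgood s hs i₀ le_rfl)).2
        have h2 : (1 / 2 : ℝ) ^ i₀ * #(A s) ≤ (1 / 2 : ℝ) ^ i₀ * E := by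
          gcongr
          exact hAE s hs
        have h3 : (sampleCount (A s) (2 ^ (M - i₀)) U : ℝ) ≤ T := by linarith
        exact_mod_cast h3)
      (fun h' hh' hne i hi => by
        obtain ⟨s, hs, rfl⟩ := hsuf h' hh' hne
        rw [hcnt, hA']
        have h1 := hgood s hs i hi
        have h2 : (1 / 2 : ℝ) ^ i * 2 ^ i = 1 := by rw [← mul_pow]; norm_num
        calc |(sampleCount (A s) (2 ^ (M - i)) U : ℝ) * 2 ^ i - #(A s)|
            = |(sampleCount (A s) (2 ^ (M - i)) U : ℝ) - (1 / 2 : ℝ) ^ i * #(A s)| * 2 ^ i := by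
              rw [← abs_of_pos (show (0 : ℝ) < 2 ^ i by positivity), ← abs_mul,
                abs_of_pos (show (0 : ℝ) < 2 ^ i by positivity)]
              congr 1
              linear_combination (#(A s) : ℝ) * h2
          _ ≤ δ * ((1 / 2 : ℝ) ^ i * E) * 2 ^ i := by gcongr
          _ = δ * E := by linear_combination δ * E * h2)
    refine abs_le.2 ⟨?_, by linarith⟩
    rcases Nat.eq_zero_or_pos τ.length with h0 | hpos
    · have : E = 0 := by
        rw [hE, peak, h0]
        simp
      rw [this, mul_zero, neg_zero, sub_zero]
      exact Nat.cast_nonneg _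
    · obtain ⟨s, hs, hsE⟩ := exists_mem_eq_sup (Finset.range τ.length) ⟨0, mem_range.2 hpos⟩
        fun s => #(EdgeList.good α (τ.drop s))
      have hs' := mem_range.1 hs
      have h1 := hlow _ (List.drop_suffix s (hist τ U)) (by
        rw [ne_eq, List.drop_eq_nil_iff, length_hist]
        omega)
      have h2 : cnt ((hist τ U).drop s) = E := by
        rw [hcnt, hA, hE, peak, hsE]
      rw [h2] at h1
      linarith

end Sketch

namespace Sketch

open Streaming

variable {n : ℕ}

/-! ### The main theorem -/

theorem isIn_drop {V : Type*} {τ : List (V × V)} {G : SimpleGraph V}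
    (h : EdgeList.IsIn τ G) (s : ℕ) : EdgeList.IsIn (τ.drop s) G :=
  ⟨by rw [List.map_drop]; exact h.1.sublist (List.drop_sublist _ _),
    fun e he => h.2 e (List.mem_of_mem_drop he)⟩

theorem _root_.SimpleGraph.IsEdgeStream.isIn_reverse {V : Type*} {σ : List (V × V)}
    {G : SimpleGraph V} (h : G.IsEdgeStream σ) : EdgeList.IsIn σ.reverse G :=
  ⟨by rw [List.map_reverse, List.nodup_reverse]; exact h.1, fun e he =>
    (h.2 s(e.1, e.2)).1 (List.mem_map.2 ⟨e, List.mem_reverse.1 he, rfl⟩)⟩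

theorem _root_.SimpleGraph.IsEdgeStream.exists_edge {V : Type*} {σ : List (V × V)}
    {G : SimpleGraph V} (h : G.IsEdgeStream σ) :
    ∀ e ∈ G.edgeSet, ∃ i, EdgeList.edge σ.reverse i = e := by
  intro e he
  obtain ⟨p, hp, rfl⟩ := List.mem_map.1 ((h.2 e).2 he)
  obtain ⟨i, hi, rfl⟩ := List.mem_iff_getElem.1 (List.mem_reverse.2 hp)
  exact ⟨⟨i, hi⟩, rfl⟩

/-- The lower bound comes from the full stream alone, the upper bound from every prefix separately.
-/
theorem peak_bounds {G : SimpleGraph (Fin n)} {α : ℕ} (hG : G.HasArboricity α)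
    {σ : List (Fin n × Fin n)} (hσ : G.IsEdgeStream σ) :
    G.maxMatchingSize ≤ peak α σ.reverse ∧ peak α σ.reverse ≤ (α + 2) * G.maxMatchingSize := by
  have hin := hσ.isIn_reverse
  constructor
  · have h1 := EdgeList.maxMatchingSize_le_card_good hin hσ.exists_edge hG
    rcases Nat.eq_zero_or_pos σ.reverse.length with h0 | hpos
    · have : #(EdgeList.good α σ.reverse) ≤ σ.reverse.length := (card_le_univ _).trans (by simp)
      omega
    · exact h1.trans (good_le_peak α σ.reverse hpos)
  · exact Finset.sup_le fun s _ => EdgeList.card_good_le (isIn_drop hin s) α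

/-- `(1 - 1/(8k))(1 + 1/(4k)) ≥ 1` and `(1 + 1/(8k))(1 + 1/(4k)) ≤ 1 + 1/k`. Rounding down cannot
drop below `E`, an integer. -/
theorem output_bounds {k B E : ℕ} {ε : ℝ} (hk : 1 ≤ k) (hkε : 1 / (k : ℝ) ≤ ε)
    (h : |(B : ℝ) - E| ≤ 1 / (8 * k) * E) :
    E ≤ B * (4 * k + 1) / (4 * k) ∧
      ((B * (4 * k + 1) / (4 * k) : ℕ) : ℝ) ≤ (1 + ε) * E := by
  have hk' : (1 : ℝ) ≤ k := by exact_mod_cast hk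
  have hE : (0 : ℝ) ≤ E := Nat.cast_nonneg _
  obtain ⟨h1, h2⟩ := abs_le.1 h
  have h3 : 1 / (8 * k : ℝ) * E * (8 * k) = E := by field_simp
  constructor
  · rw [Nat.le_div_iff_mul_le (by omega)]
    have : (E : ℝ) * (4 * k) ≤ B * (4 * k + 1) := by nlinarith
    exact_mod_cast this
  · refine Nat.cast_div_le.trans ?_
    push_cast
    have h4 : (B : ℝ) ≤ (1 + 1 / (8 * k)) * E := by linarith
    calc (B : ℝ) * (4 * k + 1) / (4 * k) ≤ (1 + 1 / (8 * k)) * E * (4 * k + 1) / (4 * k) := by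
          gcongr
      _ = (1 + 3 / 8 * (1 / k) + 1 / 32 * (1 / k) * (1 / k)) * E := by field_simp; ring
      _ ≤ (1 + ε) * E := by
          refine mul_le_mul_of_nonneg_right ?_ hE
          have h5 : 1 / (k : ℝ) ≤ 1 := by rw [div_le_one (by linarith)]; exact hk'
          have h6 : 0 ≤ 1 / (k : ℝ) := by positivity
          nlinarith

/-- One factor `exp (-M)` absorbs `M`; the other `c + 4` are each at most `n⁻²` since `2 ≤ e`,
against a union bound of `2 m ≤ n³`. -/
theorem failure_le {n M c m : ℕ} (hn : 2 ≤ n) (hM : n ^ 2 ≤ 2 ^ M) (hm : m ≤ n ^ 2) :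
    (m * M * (2 * Real.exp (-((c + 5 : ℕ) * M : ℝ))) : ℝ) ≤ 1 / (n : ℝ) ^ c := by
  have hn' : (2 : ℝ) ≤ n := by exact_mod_cast hn
  have hexp : Real.exp (-(M : ℝ)) ≤ 1 / (n : ℝ) ^ 2 := by
    rw [Real.exp_neg, ← one_div]
    refine one_div_le_one_div_of_le (by positivity) ?_
    calc (n : ℝ) ^ 2 ≤ 2 ^ M := by exact_mod_cast hM
      _ ≤ Real.exp 1 ^ M := by
          gcongr
          linarith [Real.add_one_le_exp (1 : ℝ)]
      _ = Real.exp M := by rw [← Real.exp_nat_mul, mul_one]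
  have hMexp : (M : ℝ) * Real.exp (-(M : ℝ)) ≤ 1 := by
    rw [Real.exp_neg, ← div_eq_mul_inv, div_le_one (Real.exp_pos _)]
    linarith [Real.add_one_le_exp (M : ℝ)]
  have hsplit : Real.exp (-((c + 5 : ℕ) * M : ℝ)) =
      Real.exp (-(M : ℝ)) * Real.exp (-(M : ℝ)) ^ (c + 4) := by
    rw [← pow_succ', ← Real.exp_nat_mul]
    congr 1
    push_cast
    ring
  have hpos : (0 : ℝ) < n := by linarith
  calc (m * M * (2 * Real.exp (-((c + 5 : ℕ) * M : ℝ))) : ℝ)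
      = 2 * m * (M * Real.exp (-(M : ℝ))) * Real.exp (-(M : ℝ)) ^ (c + 4) := by rw [hsplit]; ring
    _ ≤ n * (n ^ 2 : ℕ) * 1 * (1 / (n : ℝ) ^ 2) ^ (c + 4) := by gcongr
    _ = 1 / (n : ℝ) ^ c * (1 / (n : ℝ) ^ (c + 5)) := by
        push_cast
        rw [div_pow, one_pow, ← pow_mul]
        field_simp
        ring
    _ ≤ 1 / (n : ℝ) ^ c * 1 := by
        gcongr
        rw [div_le_one (by positivity)]
        exact one_le_pow₀ (by linarith)
    _ = _ := mul_one _

/-- From `2 ^ M ≤ n³` and `3 / log 2 < 5` follows `M ≤ 5 log n`, and `k² ≤ 4/ε²`, whence `5 · 4 · 5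
= 100`. The constant 15 is absorbed by 30 because `log n ≥ 1/2`. -/
theorem space_le {n M K k : ℕ} {ε : ℝ} (hn : 2 ≤ n) (hε : 0 < ε) (hε1 : ε ≤ 1)
    (hk : (k : ℝ) ≤ 2 / ε) (hM : 2 ^ M ≤ 2 * n ^ 2) :
    15 + 5 * (K * (k * k * M)) ≤
      ⌈((100 * K + 30 : ℕ) : ℝ) * (1 / ε ^ 2) * Real.log n⌉₊ := by
  have hn' : (2 : ℝ) ≤ n := by exact_mod_cast hn
  have hlog2 := Real.log_two_gt_d9
  have hlogn : Real.log 2 ≤ Real.log n := Real.log_le_log (by norm_num) hn'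
  have hMl : (M : ℝ) ≤ 5 * Real.log n := by
    have h1 : (2 : ℝ) ^ M ≤ n ^ 3 := by
      calc (2 : ℝ) ^ M ≤ 2 * n ^ 2 := by exact_mod_cast hM
        _ ≤ n * n ^ 2 := by gcongr
        _ = n ^ 3 := by ring
    have h2 := Real.log_le_log (by positivity) h1
    rw [Real.log_pow, Real.log_pow] at h2
    push_cast at h2
    have hM0 : (0 : ℝ) ≤ M := Nat.cast_nonneg _
    nlinarith
  have hinv : 1 ≤ 1 / ε ^ 2 := by
    rw [le_div_iff₀ (by positivity), one_mul]
    exact pow_le_one₀ hε.le hε1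
  have hkk : (k : ℝ) * k ≤ 4 * (1 / ε ^ 2) := by
    calc (k : ℝ) * k ≤ (2 / ε) * (2 / ε) := by gcongr
      _ = _ := by field_simp; norm_num
  have hreal : ((15 + 5 * (K * (k * k * M)) : ℕ) : ℝ) ≤
      ((100 * K + 30 : ℕ) : ℝ) * (1 / ε ^ 2) * Real.log n := by
    push_cast
    have h1 : (K : ℝ) * (k * k * M) ≤ K * (4 * (1 / ε ^ 2) * (5 * Real.log n)) := by gcongr
    have h2 : (1 : ℝ) * (1 / 2) ≤ 1 / ε ^ 2 * Real.log n := by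
      gcongr
      linarith
    linarith
  exact_mod_cast hreal.trans (Nat.le_ceil _)

theorem word_size {n m : ℕ} (hn : 2 ≤ n) (hm : m ≤ n ^ 2) :
    (2 * (m + 1) + 2) * (2 * n ^ 2) < 2 ^ (8 * (Nat.log 2 n + 1)) := by
  have h1 : n < 2 ^ (Nat.log 2 n + 1) := Nat.lt_pow_succ_log_self (by omega) n
  have h4 : 4 ≤ n ^ 2 := by nlinarith
  calc (2 * (m + 1) + 2) * (2 * n ^ 2) ≤ (2 * (n ^ 2 + 1) + 2) * (2 * n ^ 2) := by gcongr
    _ ≤ (n ^ 2 * n ^ 2) * (n ^ 2 * n ^ 2) := by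
        refine Nat.mul_le_mul ?_ (by nlinarith)
        nlinarith
    _ = n ^ 8 := by ring
    _ < (2 ^ (Nat.log 2 n + 1)) ^ 8 := Nat.pow_lt_pow_left h1 (by omega)
    _ = _ := by rw [← pow_mul, mul_comm]

theorem prob_success (c : ℕ) {n : ℕ} (hn : 2 ≤ n) (α : ℕ) {ε : ℝ} (hε : 0 < ε) (hε1 : ε ≤ 1)
    {G : SimpleGraph (Fin n)} (hG : G.HasArboricity α) {σ : List (Fin n × Fin n)}
    (hσ : G.IsEdgeStream σ) :
    1 - 1 / (n : ℝ) ^ c ≤ prob ((program (1024 * (c + 5))).run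
      ⌈((100 * (1024 * (c + 5)) + 30 : ℕ) : ℝ) * (1 / ε ^ 2) * Real.log n⌉₊
      (8 * (Nat.log 2 n + 1)) [n, α, ⌈1 / ε⌉₊] (σ.map Sketch.item))
      {X : ℕ | (G.maxMatchingSize : ℝ) ≤ X ∧
        (X : ℝ) ≤ ((α : ℝ) + 2) * (1 + ε) * G.maxMatchingSize} := by
  have hlen : σ.length ≤ n ^ 2 := by
    have := (List.Nodup.of_map _ hσ.1).length_le_card
    simpa [sq] using this
  have hε' : 1 ≤ 1 / ε := by rwa [le_div_iff₀ hε, one_mul]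
  generalize hk : ⌈1 / ε⌉₊ = k
  have hk1 : 1 ≤ k := by
    rw [← hk, Nat.one_le_ceil_iff]
    linarith
  have hkε : 1 / (k : ℝ) ≤ ε := by
    have := Nat.le_ceil (1 / ε)
    rw [hk] at this
    have hk0 : (0 : ℝ) < k := by exact_mod_cast hk1
    rw [div_le_iff₀ hε] at this
    rw [div_le_iff₀ hk0]
    linarith
  have hk2 : (k : ℝ) ≤ 2 / ε := by
    have := Nat.ceil_lt_add_one (show 0 ≤ 1 / ε by positivity)
    rw [hk] at this
    calc (k : ℝ) ≤ 1 / ε + 1 / ε := by linarith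
      _ = 2 / ε := by ring
  have hw := fun M hM => space_le (M := M) (K := 1024 * (c + 5)) hn hε hε1 hk2 hM
  obtain ⟨M, hM1, hM2, hrun⟩ := run_program (α := α) (K := 1024 * (c + 5)) (k := k) (n := n)
    (by have := hw 0 (by nlinarith); omega) (by omega) σ hw (word_size hn hlen)
  have hM : 1 ≤ M := by
    by_contra hcon
    have h4 : 4 ≤ n ^ 2 := by nlinarith
    rw [show M = 0 by omega] at hM1
    omega
  obtain ⟨bad, hbad, hgood⟩ := exists_bad α k _ M c hk1 hM rfl σ.reverse
    (by rw [List.length_reverse]; omega)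
  have hpk := peak_bounds hG hσ
  rw [hrun]
  refine le_trans ?_ (Sampling.le_prob_map_uniform _ _ bad fun U hU => ?_)
  · refine sub_le_sub_left (le_trans ?_
      (failure_le (c := c) (M := M) (m := σ.reverse.length) hn hM1 (by simpa using hlen))) 1
    have hcard : (Fintype.card (Fin σ.reverse.length → Fin (2 ^ M)) : ℝ) =
        ((2 ^ M : ℕ) : ℝ) ^ σ.reverse.length := by
      rw [Fintype.card_fun, Fintype.card_fin, Fintype.card_fin, Nat.cast_pow]
    rw [hcard, div_le_iff₀ (by positivity)]
    refine hbad.trans (le_of_eq ?_)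
    ring
  · obtain ⟨h1, h2⟩ := output_bounds hk1 hkε (hgood U hU)
    refine ⟨by exact_mod_cast hpk.1.trans h1, h2.trans ?_⟩
    have h3 : (peak α σ.reverse : ℝ) ≤ (α + 2) * G.maxMatchingSize := by exact_mod_cast hpk.2
    calc (1 + ε) * (peak α σ.reverse : ℝ) ≤ (1 + ε) * ((α + 2) * G.maxMatchingSize) := by gcongr
      _ = _ := by ring

end Sketch

theorem theorem4 (c : ℕ) :
    ∃ (A : Streaming.Program) (C D : ℕ),
      ∀ (n : ℕ), 2 ≤ n → ∀ (α : ℕ) (ε : ℝ), 0 < ε → ε ≤ 1 →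
      ∀ (G : SimpleGraph (Fin n)), G.HasArboricity α →
      ∀ (σ : List (Fin n × Fin n)), G.IsEdgeStream σ →
        1 - 1 / (n : ℝ) ^ c ≤
          Streaming.prob
            (A.run
              -- number of words of memory
              ⌈(C : ℝ) * (1 / ε ^ 2) * Real.log n⌉₊
              -- number of bits of a word
              (D * (Nat.log 2 n + 1))
              -- the program knows the number of vertices, the arboricity and the accuracy
              [n, α, ⌈1 / ε⌉₊]
              (σ.map fun e => [(e.1 : ℕ), (e.2 : ℕ)]))
            {X : ℕ | (G.maxMatchingSize : ℝ) ≤ X ∧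
              (X : ℝ) ≤ ((α : ℝ) + 2) * (1 + ε) * G.maxMatchingSize} := by
  exact ⟨Sketch.program (1024 * (c + 5)), 100 * (1024 * (c + 5)) + 30, 8,
    fun n hn α ε hε hε1 G hG σ hσ => Sketch.prob_success c hn α hε hε1 hG hσ⟩
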